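/- Let $G=(V,E)$ be a connected simple undirected graph with $n=|V|$. For distinct $u,v\in V$ let $I(u,v)$ be the set of all vertices that lie on some induced (chordless) path between $u$ and $v$, and let $I(u,u)=\emptyset$. A set $X\subseteq V$ is m-convex if $I(u,v)\subseteq X$ for all $u,v\in X$, and $H\subseteq V$ is an m-halfspace if both $H$ and $V\setminus H$ are m-convex. A labeled sample $(S,y)$ is a finite (multi)set $S$ of vertices with labels $y$ in $\{0,1\}$; its version space $\mathrm{VS}$ is the set of all m-halfspaces $H$ of $G$ that contain every sample vertex labeled $1$ and no sample vertex labeled $0$. Theorem (Listing the version space with polynomial delay). There exist an algorithm mh-list (a single random access machine program with unit-cost addition, subtraction and indirect addressing), a polynomial $p$ and a constant $c$ such that, for every connected graph $G$, given by its adjacency matrix, and every labeled sample $(S,y)$, given as a list of labeled vertices, mh-list halts and outputs every element of $\mathrm{VS}$ exactly once and nothing else, with delay at most $p(n)$ and in total time at most $\max(1,|\mathrm{VS}|)\,p(n)$, apart from at most $c|S|$ additional steps before the first output for reading the sample (which is again $\mathrm{poly}(n)$ when $S$ is a set, as then $|S|\le n$). Delay at most $p(n)$ means that the first element is completed within $p(n)$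 steps, each further element within $p(n)$ steps of the previous one, and that the algorithm halts within $p(n)$ steps of the last element (of the start, if $\mathrm{VS}=\emptyset$). -/

import Mathlib

/-! ### Monophonic halfspaces and the version space -/

namespace SimpleGraph

variable {V : Type*} (G : SimpleGraph V)

/-- An induced path: a path without chords. -/
def Walk.IsInducedPath {G : SimpleGraph V} {u v : V} (p : G.Walk u v) : Prop :=
  p.IsPath ∧ p.IsChordless

/-- The monophonic interval `I(u,v)`: all vertices that lie on some induced path between the
distinct vertices `u` and `v`; by convention `I(u,u) = ∅`. -/
def mInterval (u v : V) : Set V :=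
  {z | u ≠ v ∧ ∃ p : G.Walk u v, p.IsInducedPath ∧ z ∈ p.support}

/-- Monophonically convex sets. -/
def IsMConvex (X : Set V) : Prop :=
  ∀ u ∈ X, ∀ v ∈ X, G.mInterval u v ⊆ X

/-- Monophonic halfspaces. -/
def IsMHalfspace (H : Set V) : Prop :=
  G.IsMConvex H ∧ G.IsMConvex Hᶜ

/-- The version space of a labeled sample: all m-halfspaces consistent with it. The sample is a
finite sequence of labeled vertices (`true` for the label `1`, `false` for `0`); vertices may be
repeated. -/
def versionSpace (S : List (V × Bool)) : Set (Set V) :=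
  {H | G.IsMHalfspace H ∧ ∀ e ∈ S, (e.1 ∈ H ↔ e.2 = true)}

end SimpleGraph

/-! ### A random access machine with unit cost

Programs are finite while-programs over natural-number registers and one-dimensional arrays, with
addition and truncated subtraction as the only arithmetic operations (no multiplication, so that
unit-cost time is polynomially related to Turing machine time). -/

namespace RAM

/-- Expressions: constants, registers, array cells, sums and truncated differences. Registers and
arrays are named by natural numbers. -/
inductive Expr : Type
  | const (k : ℕ)
  | reg (x : ℕ)
  | cell (a : ℕ) (i : Expr)
  | add (e f : Expr)
  | sub (e f : Expr)

/-- Programs. Tests succeed when the value of the expression is nonzero. -/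
inductive Cmd : Type
  | skip
  | assign (x : ℕ) (e : Expr)
  | store (a : ℕ) (i e : Expr)
  | output (e : Expr)
  | seq (c d : Cmd)
  | cond (e : Expr) (c d : Cmd)
  | loop (e : Expr) (c : Cmd)

/-- Machine states: registers, arrays, the number of elementary steps executed so far, and the
sequence of all numbers output so far, each with the time at which it was output. -/
structure State where
  reg : ℕ → ℕ
  arr : ℕ → ℕ → ℕ
  clock : ℕ
  out : List (ℕ × ℕ)

/-- The value of an expression. -/
def Expr.eval (s : State) : Expr → ℕ
  | const k => k
  | reg x => s.reg x
  | cell a i => s.arr a (i.eval s)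
  | add e f => e.eval s + f.eval s
  | sub e f => e.eval s - f.eval s

/-- The number of steps needed to evaluate an expression: one per constant, memory access and
arithmetic operation. -/
def Expr.cost : Expr → ℕ
  | const _ => 1
  | reg _ => 1
  | cell _ i => i.cost + 1
  | add e f => e.cost + f.cost + 1
  | sub e f => e.cost + f.cost + 1

/-- Let `t` steps pass. -/
def State.tick (s : State) (t : ℕ) : State :=
  { s with clock := s.clock + t }

/-- `Exec c s s'`: started in state `s`, the program `c` halts, in state `s'`. -/
inductive Exec : Cmd → State → State → Prop
  | skip (s : State) : Exec .skip s (s.tick 1)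
  | assign (x : ℕ) (e : Expr) (s : State) :
      Exec (.assign x e) s
        { s.tick (e.cost + 1) with reg := Function.update s.reg x (e.eval s) }
  | store (a : ℕ) (i e : Expr) (s : State) :
      Exec (.store a i e) s
        { s.tick (i.cost + e.cost + 1) with
          arr := Function.update s.arr a (Function.update (s.arr a) (i.eval s) (e.eval s)) }
  | output (e : Expr) (s : State) :
      Exec (.output e) s
        { s.tick (e.cost + 1) with out := s.out ++ [(s.clock + (e.cost + 1), e.eval s)] }
  | seq {c d : Cmd} {s s' s'' : State} (hc : Exec c s s') (hd : Exec d s' s'') :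
      Exec (.seq c d) s s''
  | cond_true {e : Expr} {c d : Cmd} {s s' : State} (he : e.eval s ≠ 0)
      (hc : Exec c (s.tick (e.cost + 1)) s') : Exec (.cond e c d) s s'
  | cond_false {e : Expr} {c d : Cmd} {s s' : State} (he : e.eval s = 0)
      (hd : Exec d (s.tick (e.cost + 1)) s') : Exec (.cond e c d) s s'
  | loop_true {e : Expr} {c : Cmd} {s s' s'' : State} (he : e.eval s ≠ 0)
      (hc : Exec c (s.tick (e.cost + 1)) s') (hl : Exec (.loop e c) s' s'') :
      Exec (.loop e c) s s''
  | loop_false {e : Expr} {c : Cmd} {s : State} (he : e.eval s = 0) :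
      Exec (.loop e c) s (s.tick (e.cost + 1))

/-- Runs are deterministic. -/
theorem Exec.det {c : Cmd} {s t t' : State} (h : Exec c s t) (h' : Exec c s t') : t = t' := by
  induction h generalizing t' with
  | skip | assign | store | output => cases h'; rfl
  | seq _ _ ih₁ ih₂ =>
    cases h' with
    | seq a b => exact ih₂ (ih₁ a ▸ b)
  | cond_true he _ ih =>
    cases h' with
    | cond_true _ a => exact ih a
    | cond_false he' _ => exact absurd he' he
  | cond_false he _ ih =>
    cases h' with
    | cond_true he' _ => exact absurd he he'
    | cond_false _ a => exact ih a
  | loop_true he _ _ ih₁ ih₂ =>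
    cases h' with
    | loop_true _ a b => exact ih₂ (ih₁ a ▸ b)
    | loop_false he' => exact absurd he' he
  | loop_false he =>
    cases h' with
    | loop_true he' _ _ => exact absurd he he'
    | loop_false _ => rfl

open Classical in
/-- The initial state on input `G` (with vertices `0, …, n-1`) and `S`. Register `0` holds `n` and
register `1` holds the length of `S`; array `0` holds the adjacency matrix of `G`, row by row;
arrays `1` and `2` hold the vertices and the labels of `S`. Everything else is `0`. -/
noncomputable def inputState {n : ℕ} (G : SimpleGraph (Fin n)) (S : List (Fin n × Bool)) :
    State where
  reg
    | 0 => n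
    | 1 => S.length
    | _ => 0
  arr
    | 0 => fun k => if ∃ u v : Fin n, G.Adj u v ∧ k = (u : ℕ) * n + (v : ℕ) then 1 else 0
    | 1 => fun k => (S.map fun e => (e.1 : ℕ)).getD k 0
    | 2 => fun k => (S.map fun e => e.2.toNat).getD k 0
    | _ => fun _ => 0
  clock := 0
  out := []

open Classical in
/-- A set of vertices is printed as its characteristic vector, followed by the end marker `2`. -/
noncomputable def printSet {n : ℕ} (H : Set (Fin n)) : List ℕ :=
  List.ofFn (fun i : Fin n => if i ∈ H then 1 else 0) ++ [2]

/-- The times at which an end marker was output, in chronological order, that is, the times at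
which the listed sets were completed. -/
def State.outputTimes (s : State) : List ℕ :=
  (s.out.filter fun o => o.2 = 2).map Prod.fst

/-- Delay at most `d`, not counting the first `r` steps: the first listed set is completed by time
`r + d`, and every further listed set, and finally the halting of the program, comes at most `d`
steps after the completion of the previous listed set. If nothing is listed, the program halts by
time `r + d`. -/
def State.HasDelay (s : State) (r d : ℕ) : Prop :=
  List.IsChain (fun t t' => t' ≤ t + d) (r :: (s.outputTimes ++ [s.clock]))

end RAM

/-! ### Monophonic halfspaces through their cuts -/

namespace SimpleGraph

variable {V : Type*} {G : SimpleGraph V}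

/-! In a connected graph, whether `H` is an m-halfspace depends only on pairs of cut edges: the ends
of the cut edges inside `H` must form a clique, and so must those outside (`isMHalfspace_iff_cut`).

Apart from `∅` and the whole vertex set, every halfspace has a cut edge `ab`, with `a` inside. Once
`ab` is guessed, the condition becomes a 2-SAT instance. A condition on two cut edges mentions four
literals, but compared with `ab` every cut edge `zz'` has `z` in the closed neighbourhood of `a` and
`z'` in that of `b`. A neighbour of `a` outside the closed neighbourhood of `b` is forced inside,
and symmetrically. So if `z ≠ a`, either `z` is also adjacent to `b` and `zb` is a cut edge costing
one literal, or `z` is forced and only `z'` is a free literal. Two offending edges therefore cost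
two literals, and the binary clauses in `Clash` suffice (`isMHalfspace_of_implies`). By
`exists_isMHalfspace_iff`, a set of literals is realised by a halfspace iff all of them are
negative, or all positive, or for some edge the transitive closure of the implications is consistent
and refutes no pair of them.

The machine computes these closures once, by Warshall's algorithm (`run_closureCmd`). Afterwards,
whether a prefix of the characteristic vector extends to a member of the version space is a
first-order formula with boundedly many quantifiers over vertices and literals (`holds_extF`). Such
formulas are compiled mechanically into programs of polynomial running time (`Fm.run`).

With this test the members are listed in lexicographic order. A prefix is completed greedily,
preferring `0` (`run_completeCmd`). The successor search finds the last position where a `0` of the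
printed vector can become a `1` (`run_nextCmd`). Every search succeeds or ends the run, so the delay
is polynomial; `exec_enumerateCmd` combines correctness and timing by induction on the number of
sets remaining. -/

theorem Walk.IsInducedPath.of_cons {u v w : V} {h : G.Adj u v} {p : G.Walk v w}
    (hp : (Walk.cons h p).IsInducedPath) : p.IsInducedPath := by
  obtain ⟨hpath, hch⟩ := hp
  rw [Walk.cons_isPath_iff] at hpath
  refine ⟨hpath.1, Walk.isChordless_iff_forall_mem_edges.2 fun x y hx hy hxy => ?_⟩
  have := hch.mem_edges (u' := x) (v' := y) (by simp [hx]) (by simp [hy]) hxy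
  rw [Walk.edges_cons, List.mem_cons] at this
  rcases this with h' | h'
  · rw [Sym2.eq_iff] at h'
    rcases h' with ⟨rfl, rfl⟩ | ⟨rfl, rfl⟩
    · exact absurd hx hpath.2
    · exact absurd hy hpath.2
  · exact h'

theorem Walk.IsInducedPath.exists_from {w v : V} {q : G.Walk w v} (hq : q.IsInducedPath) :
    ∀ x ∈ q.support, ∃ r : G.Walk x v, r.IsInducedPath ∧ r.support ⊆ q.support := by
  induction q with
  | nil =>
    intro x hx
    simp only [Walk.support_nil, List.mem_singleton] at hx
    subst hx
    exact ⟨_, hq, fun _ h => h⟩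
  | cons h q ih =>
    intro x hx
    rw [Walk.support_cons, List.mem_cons] at hx
    rcases hx with rfl | hx
    · exact ⟨_, hq, fun _ h => h⟩
    · obtain ⟨r, hr, hs⟩ := ih hq.of_cons x hx
      exact ⟨r, hr, fun z hz => by simp [hs hz]⟩

/-- The recursion drops the head of `q` as long as the tail still contains a neighbour of `u`. Thus
`u` is attached at its last neighbour on `q`, and no chord at `u` arises. -/
theorem Walk.IsInducedPath.exists_cons {w v : V} {q : G.Walk w v} (hq : q.IsInducedPath) {u : V}
    (hu : u ∉ q.support) (hadj : ∃ x ∈ q.support, G.Adj u x) :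
    ∃ r : G.Walk u v, r.IsInducedPath ∧ r.support ⊆ u :: q.support := by
  induction q with
  | @nil w =>
    obtain ⟨x, hx, hux⟩ := hadj
    simp only [Walk.support_nil, List.mem_singleton] at hx
    subst hx
    refine ⟨hux.toWalk, ⟨?_, hux.isChordless_toWalk⟩, by simp⟩
    simp [Walk.cons_isPath_iff, hux.ne]
  | @cons w w' v h q ih =>
    rw [Walk.support_cons, List.mem_cons, not_or] at hu
    by_cases hq' : ∃ x ∈ q.support, G.Adj u x
    · obtain ⟨r, hr, hs⟩ := ih hq.of_cons hu.2 hq'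
      refine ⟨r, hr, fun z hz => ?_⟩
      have := hs hz
      simp only [List.mem_cons, Walk.support_cons] at this ⊢
      tauto
    · push Not at hq'
      obtain ⟨x, hx, hux⟩ := hadj
      rw [Walk.support_cons, List.mem_cons] at hx
      rcases hx with rfl | hx
      · have hnadj : ∀ y ∈ (Walk.cons h q).support, G.Adj u y → y = x := by
          intro y hy huy
          rw [Walk.support_cons, List.mem_cons] at hy
          rcases hy with rfl | hy
          · rfl
          · exact absurd huy (hq' y hy)
        refine ⟨Walk.cons hux (Walk.cons h q), ⟨?_, ?_⟩, by simp⟩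
        · rw [Walk.cons_isPath_iff]
          exact ⟨hq.1, by simp [hu.1, hu.2]⟩
        · rw [Walk.isChordless_iff_forall_mem_edges]
          intro y z hy hz hyz
          rw [Walk.support_cons, List.mem_cons] at hy hz
          rw [Walk.edges_cons, List.mem_cons]
          rcases hy with rfl | hy <;> rcases hz with rfl | hz
          · exact absurd hyz (G.irrefl)
          · rw [hnadj z hz hyz]; exact Or.inl rfl
          · rw [hnadj y hy hyz.symm]; exact Or.inl Sym2.eq_swap
          · exact Or.inr (hq.2.mem_edges hy hz hyz)
      · exact absurd hux (hq' x hx)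

/-- Vertices are prepended one at a time to an induced path. A vertex already on it cuts the path
down to a suffix; any other is attached at its last neighbour. -/
theorem Walk.exists_isInducedPath {u v : V} (p : G.Walk u v) :
    ∃ q : G.Walk u v, q.IsInducedPath ∧ q.support ⊆ p.support := by
  induction p with
  | nil =>
    refine ⟨Walk.nil, ⟨by simp, ?_⟩, fun _ h => h⟩
    rw [Walk.isChordless_iff_forall_mem_edges]
    intro y z hy hz hyz
    simp only [Walk.support_nil, List.mem_singleton] at hy hz
    subst hy hz
    exact absurd hyz (G.irrefl)
  | @cons u w v h p ih =>
    obtain ⟨q, hq, hs⟩ := ih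
    by_cases hu : u ∈ q.support
    · obtain ⟨r, hr, hrs⟩ := hq.exists_from u hu
      exact ⟨r, hr, fun z hz => by simp [hs (hrs hz)]⟩
    · obtain ⟨r, hr, hrs⟩ := hq.exists_cons hu ⟨w, q.start_mem_support, h⟩
      refine ⟨r, hr, fun z hz => ?_⟩
      have := hrs hz
      simp only [List.mem_cons, Walk.support_cons] at this ⊢
      exact this.imp_right fun h => hs h

theorem IsMConvex.support_subset {X : Set V} (hX : G.IsMConvex X) {u v : V} (hu : u ∈ X)
    (hv : v ∈ X) {p : G.Walk u v} (hp : p.IsInducedPath) : ∀ z ∈ p.support, z ∈ X := by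
  intro z hz
  by_cases huv : u = v
  · subst huv
    rw [(Walk.isPath_iff_nil.1 hp.1).eq_nil] at hz
    simp only [Walk.support_nil, List.mem_singleton] at hz
    exact hz ▸ hu
  · exact hX u hu v hv ⟨huv, p, hp, hz⟩

/-- The inner vertex boundary of a convex set with convex complement is a clique. -/
theorem IsMConvex.adj_of_cut (hG : G.Connected) {H : Set V} (hH : G.IsMConvex H)
    (hHc : G.IsMConvex Hᶜ) {x x' y y' : V} (hx : G.Adj x x') (hy : G.Adj y y') (xH : x ∈ H)
    (xH' : x' ∉ H) (yH : y ∈ H) (yH' : y' ∉ H) : x = y ∨ G.Adj x y := by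
  by_cases hxy : x = y
  · exact Or.inl hxy
  refine Or.inr ?_
  -- An induced path between the outer ends stays outside `H`. An induced path from `x` to `y` taken
  -- from the detour along it stays inside `H`, so it can only use `x` and `y` and must be an edge.
  obtain ⟨p⟩ := hG x' y'
  obtain ⟨q, hq, -⟩ := p.exists_isInducedPath
  have hqs := hHc.support_subset xH' yH' hq
  obtain ⟨r, hr, hrs⟩ := (Walk.cons hx (q.concat hy.symm)).exists_isInducedPath
  have hrH := hH.support_subset xH yH hr
  have hsub : ∀ z ∈ r.support, z = x ∨ z = y := by
    intro z hz
    have h1 := hrs hz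
    rw [Walk.support_cons, List.mem_cons, Walk.support_concat, List.mem_append,
      List.mem_singleton] at h1
    rcases h1 with h1 | h1 | h1
    · exact Or.inl h1
    · exact absurd (hrH z hz) (hqs z h1)
    · exact Or.inr h1
  cases r with
  | nil => exact absurd rfl hxy
  | @cons _ w _ h r =>
    rcases hsub w (by simp) with rfl | rfl
    · exact absurd h (G.irrefl)
    · exact h

/-- A set whose inner vertex boundary is a clique is convex. -/
theorem isMConvex_of_cut {H : Set V}
    (h : ∀ x x' y y', G.Adj x x' → G.Adj y y' → x ∈ H → x' ∉ H → y ∈ H → y' ∉ H →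
      x = y ∨ G.Adj x y) : G.IsMConvex H := by
  classical
  rintro u hu v hv z ⟨-, p, hp, hz⟩
  by_contra hzH
  -- The path leaves `H` before `z` and returns after it. The inner ends of these two cut edges are
  -- distinct, hence adjacent, and their edge is a chord bypassing `z`.
  obtain ⟨d, hd, hd1, hd2⟩ := (p.takeUntil z hz).exists_boundary_dart H hu hzH
  obtain ⟨e, he, he1, he2⟩ := (p.dropUntil z hz).reverse.exists_boundary_dart H hv hzH
  have hdt : d.fst ∈ (p.takeUntil z hz).support := Walk.dart_fst_mem_support_of_mem_darts _ hd
  have het : e.fst ∈ (p.dropUntil z hz).support := by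
    have := Walk.dart_fst_mem_support_of_mem_darts _ he
    simpa using this
  have hdisj : ∀ w, w ∈ (p.takeUntil z hz).support → w ∈ (p.dropUntil z hz).support →
      w = z := by
    intro w h1 h2
    by_contra hwz
    have hpath := hp.1
    rw [← p.take_spec hz] at hpath
    have hnd := hpath.support_nodup
    rw [Walk.support_append] at hnd
    have h3 : w ∈ (p.dropUntil z hz).support.tail := by
      rw [← Walk.cons_tail_support, List.mem_cons] at h2
      exact h2.resolve_left hwz
    exact (List.nodup_append.1 hnd).2.2 w h1 w h3 rfl
  have hne : d.fst ≠ e.fst := fun h => hzH (hdisj _ hdt (h ▸ het) ▸ hd1)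
  have hadj := (h _ _ _ _ d.adj e.adj hd1 hd2 he1 he2).resolve_left hne
  have hmem := hp.2.mem_edges (p.support_takeUntil_subset_support hz hdt)
    (p.support_dropUntil_subset_support hz het) hadj
  -- Chordlessness puts the edge into one half of the path. That half then contains both ends, but
  -- the halves share only `z`, which is not in `H`.
  rw [← p.take_spec hz, Walk.edges_append, List.mem_append] at hmem
  rcases hmem with hmem | hmem
  · exact hzH (hdisj _ (Walk.snd_mem_support_of_mem_edges _ hmem) het ▸ he1)
  · exact hzH (hdisj _ hdt (Walk.fst_mem_support_of_mem_edges _ hmem) ▸ hd1)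

/-- This trades induced paths for a condition on pairs of edges, the form in which clauses can be
read off. -/
theorem isMHalfspace_iff_cut (hG : G.Connected) {H : Set V} :
    G.IsMHalfspace H ↔ ∀ x x' y y', G.Adj x x' → G.Adj y y' → x ∈ H → x' ∉ H → y ∈ H → y' ∉ H →
      (x = y ∨ G.Adj x y) ∧ (x' = y' ∨ G.Adj x' y') := by
  constructor
  · rintro ⟨h, hc⟩ x x' y y' hx hy xH xH' yH yH'
    have hc' : G.IsMConvex Hᶜᶜ := by rwa [compl_compl]
    exact ⟨h.adj_of_cut hG hc hx hy xH xH' yH yH',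
      hc.adj_of_cut hG hc' hx.symm hy.symm xH' (by simpa) yH' (by simpa)⟩
  · intro h
    refine ⟨isMConvex_of_cut fun x x' y y' hx hy xH xH' yH yH' =>
      (h x x' y y' hx hy xH xH' yH yH').1, isMConvex_of_cut fun x x' y y' hx hy xH xH' yH yH' => ?_⟩
    exact (h x' x y' y hx.symm hy.symm (by simpa using xH') xH (by simpa using yH') yH).2

end SimpleGraph

/-! ### The halfspaces cut by a given edge as the solutions of a 2-SAT instance -/

namespace SimpleGraph

/-- Literals: `(v, true)` says that `v` is in the halfspace and `(v, false)` that it is not. -/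
abbrev Lit (V : Type*) := V × Bool

variable {V : Type*}

/-- The complementary literal. -/
def Lit.neg (l : Lit V) : Lit V := (l.1, !l.2)

/-- The literal `l` is true for the set `H`. -/
def Lit.Sat (H : Set V) (l : Lit V) : Prop := l.1 ∈ H ↔ l.2 = true

@[simp] theorem Lit.neg_neg (l : Lit V) : l.neg.neg = l := by simp [Lit.neg]

@[simp] theorem Lit.neg_mk (v : V) (b : Bool) : Lit.neg (v, b) = (v, !b) := rfl

@[simp] theorem Lit.sat_mk_true (H : Set V) (v : V) : Lit.Sat H (v, true) ↔ v ∈ H := by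
  simp [Lit.Sat]

@[simp] theorem Lit.sat_mk_false (H : Set V) (v : V) : Lit.Sat H (v, false) ↔ v ∉ H := by
  simp [Lit.Sat]

@[simp] theorem Lit.sat_neg (H : Set V) (l : Lit V) : l.neg.Sat H ↔ ¬ l.Sat H := by
  obtain ⟨v, b⟩ := l
  cases b <;> simp

/-- A set of literals that violates no clause of a satisfiable 2-SAT instance closed under
resolution extends to a solution. -/
theorem Lit.exists_extension [Finite V] {R : Lit V → Lit V → Prop} (hrefl : ∀ l, R l l)
    (htrans : ∀ l m k, R l m → R m k → R l k) (hskew : ∀ l m, R l m → R m.neg l.neg)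
    (hcons : ∀ l, ¬ (R l l.neg ∧ R l.neg l)) {c : Set (Lit V)}
    (hc : ∀ p ∈ c, ∀ q ∈ c, ¬ R p q.neg) :
    ∃ H : Set V, (∀ l ∈ c, l.Sat H) ∧ ∀ l m, R l m → l.Sat H → m.Sat H := by
  -- A maximal conflict-free set of literals will turn out to be a full assignment.
  obtain ⟨M, hcM, hM⟩ := Finite.exists_le_maximal
    (p := fun c : Set (Lit V) => ∀ p ∈ c, ∀ q ∈ c, ¬ R p q.neg) hc
  have hadd : ∀ p, (¬ R p p.neg) → (∀ q ∈ M, ¬ R q p.neg) → p ∈ M := by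
    intro p hp hq
    have : insert p M ≤ M := hM.2 (y := insert p M) (by
      rintro r (rfl | hr) q (rfl | hq')
      · exact hp
      · intro h
        exact hq q hq' (by simpa using hskew _ _ h)
      · exact hq r hr
      · exact hM.1 r hr q hq') (Set.subset_insert p M)
    exact this (Set.mem_insert p M)
  -- If `q ∈ M` blocks `p`, then `q` implies `p.neg` and, contrapositively, `p` implies `q.neg`. Any
  -- conflict of `p.neg`, with itself or with some `r ∈ M`, would pass through `p` and give a
  -- conflict with `q` inside `M`.
  have htot' : ∀ p, ¬ R p p.neg → p ∈ M ∨ p.neg ∈ M := by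
    intro p hp
    by_cases h : ∃ q ∈ M, R q p.neg
    · obtain ⟨q, hq, hqp⟩ := h
      refine Or.inr (hadd _ ?_ ?_)
      · rw [Lit.neg_neg]
        intro h
        refine hM.1 q hq q hq (htrans _ _ _ (htrans _ _ _ hqp h) ?_)
        simpa using hskew _ _ hqp
      · rw [Lit.neg_neg]
        intro r hr h
        refine hM.1 r hr q hq (htrans _ _ _ h ?_)
        simpa using hskew _ _ hqp
    · push Not at h
      exact Or.inl (hadd p hp h)
  have htot : ∀ p, p ∈ M ∨ p.neg ∈ M := by
    intro p
    by_cases h : R p p.neg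
    · have := htot' p.neg (by rw [Lit.neg_neg]; exact fun h' => hcons p ⟨h, h'⟩)
      rw [Lit.neg_neg] at this
      exact this.symm
    · exact htot' p h
  have hM' : ∀ p ∈ M, p.neg ∉ M := fun p hp hn =>
    hM.1 p hp _ hn (by rw [Lit.neg_neg]; exact hrefl p)
  have hsat : ∀ l : Lit V, l.Sat {v | (v, true) ∈ M} ↔ l ∈ M := by
    rintro ⟨v, b⟩
    cases b
    · rw [Lit.sat_mk_false, Set.mem_ofPred_eq]
      exact ⟨fun h => (htot (v, true)).resolve_left h, fun h => hM' _ h⟩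
    · simp
  refine ⟨{v | (v, true) ∈ M}, fun l hl => (hsat l).2 (hcM hl), fun l m hlm hl => ?_⟩
  rw [hsat] at hl ⊢
  refine (htot m).resolve_right fun hm => hM.1 l hl _ hm ?_
  rwa [Lit.neg_neg]

/-! ### Clauses attached to a cut edge -/

variable (G : SimpleGraph V)

/-- The literals that hold because `a` is in the halfspace and its neighbour `b` is not. -/
def Forced (a b : V) (l : Lit V) : Prop :=
  l = (a, true) ∨ l = (b, false) ∨
    (l.2 = true ∧ G.Adj a l.1 ∧ l.1 ≠ b ∧ ¬ G.Adj b l.1) ∨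
    (l.2 = false ∧ G.Adj b l.1 ∧ l.1 ≠ a ∧ ¬ G.Adj a l.1)

/-- The literals `l` and `m` exclude each other, for halfspaces with `a` inside and `b` outside:
together with the forced literals they yield two cut edges that violate the clique condition. -/
def Clash (a b : V) (l m : Lit V) : Prop :=
  (l = m ∧ G.Forced a b l.neg) ∨
    ∃ x x' y y', G.Adj x x' ∧ G.Adj y y' ∧
      ((x ≠ y ∧ ¬ G.Adj x y) ∨ (x' ≠ y' ∧ ¬ G.Adj x' y')) ∧
      ((x, true) = l ∨ (x, true) = m ∨ G.Forced a b (x, true)) ∧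
      ((x', false) = l ∨ (x', false) = m ∨ G.Forced a b (x', false)) ∧
      ((y, true) = l ∨ (y, true) = m ∨ G.Forced a b (y, true)) ∧
      ((y', false) = l ∨ (y', false) = m ∨ G.Forced a b (y', false))

/-- The implications of the 2-SAT instance. -/
def Implies (a b : V) (l m : Lit V) : Prop := l = m ∨ G.Clash a b l m.neg

variable {G}

theorem Clash.symm {a b : V} {l m : Lit V} (h : G.Clash a b l m) : G.Clash a b m l := by
  rcases h with ⟨rfl, h⟩ | ⟨x, x', y, y', hx, hy, hb, h1, h2, h3, h4⟩
  · exact Or.inl ⟨rfl, h⟩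
  · exact Or.inr ⟨x, x', y, y', hx, hy, hb, or_left_comm.1 h1, or_left_comm.1 h2,
      or_left_comm.1 h3, or_left_comm.1 h4⟩

theorem Implies.contrapose {a b : V} {l m : Lit V} (h : G.Implies a b l m) :
    G.Implies a b m.neg l.neg := by
  rcases h with rfl | h
  · exact Or.inl rfl
  · refine Or.inr ?_
    rw [Lit.neg_neg]
    exact h.symm

/-- Reversing a chain of implications link by link gives the skew symmetry that
`Lit.exists_extension` requires. -/
theorem transGen_implies_contrapose {a b : V} {l m : Lit V}
    (h : Relation.TransGen (G.Implies a b) l m) :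
    Relation.TransGen (G.Implies a b) m.neg l.neg := by
  induction h with
  | single h => exact .single h.contrapose
  | tail _ h ih => exact .head h.contrapose ih

/-- A neighbour `v` of `a` outside `H` makes `av` a cut edge, so `v` must be `b` or adjacent to `b`.
The negative case is symmetric. -/
theorem Forced.sat (hG : G.Connected) {H : Set V} (hH : G.IsMHalfspace H) {a b : V}
    (hab : G.Adj a b) (ha : a ∈ H) (hb : b ∉ H) {l : Lit V} (hl : G.Forced a b l) : l.Sat H := by
  rw [isMHalfspace_iff_cut hG] at hH
  obtain ⟨v, s⟩ := l
  rcases hl with h | h | ⟨h, h1, h2, h3⟩ | ⟨h, h1, h2, h3⟩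
  · rw [h]; simpa
  · rw [h]; simpa
  · simp only at h h1 h2 h3
    subst h
    rw [Lit.sat_mk_true]
    by_contra hv
    rcases (hH a b a v hab h1 ha hb ha hv).2 with h4 | h4
    · exact h2 h4.symm
    · exact h3 h4
  · simp only at h h1 h2 h3
    subst h
    rw [Lit.sat_mk_false]
    intro hv
    rcases (hH a b v b hab h1.symm ha hb hv hb).1 with h4 | h4
    · exact h2 h4.symm
    · exact h3 h4

theorem Clash.not_sat (hG : G.Connected) {H : Set V} (hH : G.IsMHalfspace H) {a b : V}
    (hab : G.Adj a b) (ha : a ∈ H) (hb : b ∉ H) {l m : Lit V} (h : G.Clash a b l m)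
    (hl : l.Sat H) : ¬ m.Sat H := by
  intro hm
  rcases h with ⟨rfl, h⟩ | ⟨x, x', y, y', hx, hy, hbad, h1, h2, h3, h4⟩
  · have := h.sat hG hH hab ha hb
    rw [Lit.sat_neg] at this
    exact this hl
  · have key : ∀ k : Lit V, k = l ∨ k = m ∨ G.Forced a b k → k.Sat H := by
      rintro k (rfl | rfl | h)
      · exact hl
      · exact hm
      · exact h.sat hG hH hab ha hb
    have h1 := key _ h1
    have h2 := key _ h2
    have h3 := key _ h3
    have h4 := key _ h4
    rw [Lit.sat_mk_true] at h1 h3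
    rw [Lit.sat_mk_false] at h2 h4
    have := (isMHalfspace_iff_cut hG).1 hH x x' y y' hx hy h1 h2 h3 h4
    tauto

theorem Implies.sat (hG : G.Connected) {H : Set V} (hH : G.IsMHalfspace H) {a b : V}
    (hab : G.Adj a b) (ha : a ∈ H) (hb : b ∉ H) {l m : Lit V} (h : G.Implies a b l m)
    (hl : l.Sat H) : m.Sat H := by
  rcases h with rfl | h
  · exact hl
  · simpa using h.not_sat hG hH hab ha hb hl

theorem transGen_implies_sat (hG : G.Connected) {H : Set V} (hH : G.IsMHalfspace H) {a b : V}
    (hab : G.Adj a b) (ha : a ∈ H) (hb : b ∉ H) {l m : Lit V}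
    (h : Relation.TransGen (G.Implies a b) l m) (hl : l.Sat H) : m.Sat H := by
  induction h with
  | single h => exact h.sat hG hH hab ha hb hl
  | tail _ h ih => exact h.sat hG hH hab ha hb ih

/-- Every solution of the 2-SAT instance is a halfspace. -/
theorem isMHalfspace_of_implies (hG : G.Connected) {H : Set V} {a b : V} (hab : G.Adj a b)
    (h : ∀ l m, G.Implies a b l m → l.Sat H → m.Sat H) : G.IsMHalfspace H := by
  have hclash : ∀ l m, G.Clash a b l m → l.Sat H → m.Sat H → False := by
    intro l m hlm hl hm
    have := h l m.neg (Or.inr (by rwa [Lit.neg_neg])) hl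
    rw [Lit.sat_neg] at this
    exact this hm
  have hforced : ∀ l, G.Forced a b l → l.Sat H := by
    intro l hl
    by_contra hn
    have hn' : l.neg.Sat H := by rwa [Lit.sat_neg]
    exact hclash l.neg l.neg (Or.inl ⟨rfl, by rwa [Lit.neg_neg]⟩) hn' hn'
  have hfa : G.Forced a b (a, true) := Or.inl rfl
  have hfb : G.Forced a b (b, false) := Or.inr (Or.inl rfl)
  have ha : a ∈ H := by simpa using hforced _ hfa
  have hb : b ∉ H := by simpa using hforced _ hfb
  -- Comparing a cut edge with `ab` needs only its own two literals, since those of `ab` are forced.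
  have hnear : ∀ x x', G.Adj x x' → x ∈ H → x' ∉ H →
      (a = x ∨ G.Adj a x) ∧ (b = x' ∨ G.Adj b x') := by
    intro x x' hx xH xH'
    by_contra hbad
    refine hclash (x, true) (x', false)
      (Or.inr ⟨a, b, x, x', hab, hx, by tauto, ?_, ?_, ?_, ?_⟩) (by simpa) (by simpa)
    · exact Or.inr (Or.inr hfa)
    · exact Or.inr (Or.inr hfb)
    · exact Or.inl rfl
    · exact Or.inr (Or.inl rfl)
  rw [isMHalfspace_iff_cut hG]
  intro x x' y y' hx hy xH xH' yH yH'
  have hxn := hnear x x' hx xH xH'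
  have hyn := hnear y y' hy yH yH'
  constructor
  · by_contra hbad
    push Not at hbad
    -- `x = a` would make `hnear` for `y` contradict `hbad`.
    have hax : G.Adj a x := hxn.1.resolve_left fun e => by
      subst e
      exact hyn.1.elim hbad.1 hbad.2
    have hay : G.Adj a y := hyn.1.resolve_left fun e => by
      subst e
      exact hxn.1.elim (fun e => hbad.1 e.symm) (fun e => hbad.2 e.symm)
    -- The reduction to two literals: the outer end `z'` may be replaced by some `w` so that the
    -- edge `zw` uses one unforced literal at most. If `z` is adjacent to `b`, take `w = b`;
    -- otherwise `z` is forced and `w = z'` serves.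
    have wit : ∀ z z', G.Adj z z' → z ∈ H → z' ∉ H → G.Adj a z → ∃ (l : Lit V) (w : V),
        l.Sat H ∧ G.Adj z w ∧ ((z, true) = l ∨ G.Forced a b (z, true)) ∧
          ((w, false) = l ∨ G.Forced a b (w, false)) := by
      intro z z' hz zH zH' haz
      by_cases hbz : G.Adj b z
      · exact ⟨(z, true), b, by simpa, hbz.symm, Or.inl rfl, Or.inr hfb⟩
      · refine ⟨(z', false), z', by simpa, hz, Or.inr ?_, Or.inl rfl⟩
        exact Or.inr (Or.inr (Or.inl ⟨rfl, haz, fun e => hb (e ▸ zH), hbz⟩))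
    obtain ⟨l, w, hl, hxw, hl1, hl2⟩ := wit x x' hx xH xH' hax
    obtain ⟨m, u, hm, hyu, hm1, hm2⟩ := wit y y' hy yH yH' hay
    exact hclash l m (Or.inr ⟨x, w, y, u, hxw, hyu, Or.inl hbad, hl1.imp_right Or.inr,
      hl2.imp_right Or.inr, Or.inr hm1, Or.inr hm2⟩) hl hm
  · by_contra hbad
    push Not at hbad
    have hbx : G.Adj b x' := hxn.2.resolve_left fun e => by
      subst e
      exact hyn.2.elim hbad.1 hbad.2
    have hby : G.Adj b y' := hyn.2.resolve_left fun e => by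
      subst e
      exact hxn.2.elim (fun e => hbad.1 e.symm) (fun e => hbad.2 e.symm)
    -- The mirror image: now the inner end is replaced, by `a` whenever possible.
    have wit : ∀ z z', G.Adj z z' → z ∈ H → z' ∉ H → G.Adj b z' → ∃ (l : Lit V) (w : V),
        l.Sat H ∧ G.Adj w z' ∧ ((z', false) = l ∨ G.Forced a b (z', false)) ∧
          ((w, true) = l ∨ G.Forced a b (w, true)) := by
      intro z z' hz zH zH' hbz
      by_cases haz : G.Adj a z'
      · exact ⟨(z', false), a, by simpa, haz, Or.inl rfl, Or.inr hfa⟩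
      · refine ⟨(z, true), z, by simpa, hz, Or.inr ?_, Or.inl rfl⟩
        exact Or.inr (Or.inr (Or.inr ⟨rfl, hbz, fun e => zH' ((show z' = a from e) ▸ ha), haz⟩))
    obtain ⟨l, w, hl, hxw, hl1, hl2⟩ := wit x x' hx xH xH' hbx
    obtain ⟨m, u, hm, hyu, hm1, hm2⟩ := wit y y' hy yH yH' hby
    exact hclash l m (Or.inr ⟨w, x', u, y', hxw, hyu, Or.inr hbad, hl2.imp_right Or.inr,
      hl1.imp_right Or.inr, Or.inr hm2, Or.inr hm1⟩) hl hm

/-- The consistency criterion: which sets of literals hold for some halfspace. -/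
theorem exists_isMHalfspace_iff [Finite V] (hG : G.Connected) (c : Lit V → Prop) :
    (∃ H, G.IsMHalfspace H ∧ ∀ l, c l → l.Sat H) ↔
      (∀ l, c l → l.2 = false) ∨ (∀ l, c l → l.2 = true) ∨
      ∃ a b, G.Adj a b ∧
        (∀ l, ¬ (Relation.TransGen (G.Implies a b) l l.neg ∧
          Relation.TransGen (G.Implies a b) l.neg l)) ∧
        ∀ l m, c l → c m → ¬ Relation.TransGen (G.Implies a b) l m.neg := by
  constructor
  · rintro ⟨H, hH, hc⟩
    by_cases h0 : H = ∅
    · left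
      rintro ⟨v, s⟩ hl
      have := hc _ hl
      cases s
      · rfl
      · simp [h0] at this
    by_cases h1 : H = Set.univ
    · right; left
      rintro ⟨v, s⟩ hl
      have := hc _ hl
      cases s
      · simp [h1] at this
      · rfl
    right; right
    obtain ⟨u, hu⟩ := Set.nonempty_iff_ne_empty.2 h0
    obtain ⟨v, hv⟩ := (Set.ne_univ_iff_exists_notMem H).1 h1
    -- Connectedness supplies a cut edge of a nontrivial halfspace.
    obtain ⟨p⟩ := hG u v
    obtain ⟨d, -, ha, hb⟩ := p.exists_boundary_dart H hu hv
    refine ⟨d.fst, d.snd, d.adj, fun l hl => ?_, fun l m hl hm hlm => ?_⟩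
    · have h1 := fun h => transGen_implies_sat hG hH d.adj ha hb hl.1 h
      have h2 := fun h => transGen_implies_sat hG hH d.adj ha hb hl.2 h
      rw [Lit.sat_neg] at h1 h2
      tauto
    · have := transGen_implies_sat hG hH d.adj ha hb hlm (hc l hl)
      rw [Lit.sat_neg] at this
      exact this (hc m hm)
  · rintro (h | h | ⟨a, b, hab, h1, h2⟩)
    · refine ⟨∅, (isMHalfspace_iff_cut hG).2 (by simp), ?_⟩
      rintro ⟨v, s⟩ hl
      have := h _ hl
      simp only at this
      subst this
      simp
    · refine ⟨Set.univ, (isMHalfspace_iff_cut hG).2 (by simp), ?_⟩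
      rintro ⟨v, s⟩ hl
      have := h _ hl
      simp only at this
      subst this
      simp
    · obtain ⟨H, hH, hR⟩ := Lit.exists_extension (R := Relation.TransGen (G.Implies a b))
        (fun l => .single (Or.inl rfl)) (fun l m k h h' => h.trans h')
        (fun l m h => transGen_implies_contrapose h) h1 (c := {l | c l})
        (fun p hp q hq => h2 p q hp hq)
      exact ⟨H, isMHalfspace_of_implies hG hab fun l m h => hR l m (.single h), hH⟩

end SimpleGraph

/-! ### Reasoning about machine programs -/

namespace RAM

open Function

/-- The value of an expression as a function of the memory. -/
def Expr.ev (ρ : ℕ → ℕ) (A : ℕ → ℕ → ℕ) : Expr → ℕ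
  | const k => k
  | reg x => ρ x
  | cell a i => A a (i.ev ρ A)
  | add e f => e.ev ρ A + f.ev ρ A
  | sub e f => e.ev ρ A - f.ev ρ A

theorem Expr.eval_eq_ev (s : State) (e : Expr) : e.eval s = e.ev s.reg s.arr := by
  induction e <;> simp_all [Expr.eval, Expr.ev]

/-- Started with memory `ρ`, `A`, the program `c` halts within `T` steps and without any output,
and its final memory satisfies `Q`. -/
def Run (c : Cmd) (T : ℕ) (ρ : ℕ → ℕ) (A : ℕ → ℕ → ℕ)
    (Q : (ℕ → ℕ) → (ℕ → ℕ → ℕ) → Prop) : Prop :=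
  ∀ t o, ∃ ρ' A' t', Exec c ⟨ρ, A, t, o⟩ ⟨ρ', A', t', o⟩ ∧ t' ≤ t + T ∧ Q ρ' A'

namespace Run

variable {ρ : ℕ → ℕ} {A : ℕ → ℕ → ℕ} {Q Q' : (ℕ → ℕ) → (ℕ → ℕ → ℕ) → Prop} {T T' : ℕ}
  {c d : Cmd} {e i : Expr}

theorem mono (h : Run c T ρ A Q) (hT : T ≤ T') (hQ : ∀ ρ' A', Q ρ' A' → Q' ρ' A') :
    Run c T' ρ A Q' := by
  intro t o
  obtain ⟨ρ', A', t', h1, h2, h3⟩ := h t o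
  exact ⟨ρ', A', t', h1, by omega, hQ _ _ h3⟩

theorem imp (h : Run c T ρ A Q) (hQ : ∀ ρ' A', Q ρ' A' → Q' ρ' A') : Run c T ρ A Q' :=
  h.mono le_rfl hQ

theorem skip (h : Q ρ A) : Run .skip 1 ρ A Q :=
  fun t o => ⟨ρ, A, t + 1, Exec.skip ⟨ρ, A, t, o⟩, le_rfl, h⟩

theorem assign {x : ℕ} (h : Q (update ρ x (e.ev ρ A)) A) :
    Run (.assign x e) (e.cost + 1) ρ A Q := by
  intro t o
  refine ⟨_, A, t + (e.cost + 1), ?_, le_rfl, h⟩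
  have := Exec.assign x e ⟨ρ, A, t, o⟩
  rwa [Expr.eval_eq_ev] at this

theorem store {a : ℕ} (h : Q ρ (update A a (update (A a) (i.ev ρ A) (e.ev ρ A)))) :
    Run (.store a i e) (i.cost + e.cost + 1) ρ A Q := by
  intro t o
  refine ⟨ρ, _, t + (i.cost + e.cost + 1), ?_, le_rfl, h⟩
  have := Exec.store a i e ⟨ρ, A, t, o⟩
  rwa [Expr.eval_eq_ev, Expr.eval_eq_ev] at this

theorem seq (h : Run c T ρ A fun ρ' A' => Run d T' ρ' A' Q) : Run (.seq c d) (T + T') ρ A Q := by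
  intro t o
  obtain ⟨ρ', A', t', h1, h2, h3⟩ := h t o
  obtain ⟨ρ'', A'', t'', h4, h5, h6⟩ := h3 t' o
  exact ⟨ρ'', A'', t'', h1.seq h4, by omega, h6⟩

theorem cond (h1 : e.ev ρ A ≠ 0 → Run c T ρ A Q) (h0 : e.ev ρ A = 0 → Run d T ρ A Q) :
    Run (.cond e c d) (e.cost + 1 + T) ρ A Q := by
  intro t o
  by_cases he : e.ev ρ A = 0
  · obtain ⟨ρ', A', t', h1, h2, h3⟩ := h0 he (t + (e.cost + 1)) o
    exact ⟨ρ', A', t', Exec.cond_false (by rwa [Expr.eval_eq_ev]) h1, by omega, h3⟩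
  · obtain ⟨ρ', A', t', h1, h2, h3⟩ := h1 he (t + (e.cost + 1)) o
    exact ⟨ρ', A', t', Exec.cond_true (by rwa [Expr.eval_eq_ev]) h1, by omega, h3⟩

end Run

/-- `for x in 0, …, b - 1 do c`, where `b` is the value of a register. -/
def forLoop (x b : ℕ) (c : Cmd) : Cmd :=
  .seq (.assign x (.const 0))
    (.loop (.sub (.reg b) (.reg x)) (.seq c (.assign x (.add (.reg x) (.const 1)))))

/-- The time for `N` rounds of a loop with a body that takes time `T`. -/
def forTime (N T : ℕ) : ℕ := N * (T + 8) + 6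

/-- The invariant rule for counted loops. A round pays 4 steps for the test and 4 for the increment;
the initial assignment and the last test account for the remaining 6. -/
theorem Run.forLoop {ρ : ℕ → ℕ} {A : ℕ → ℕ → ℕ} {Q : (ℕ → ℕ) → (ℕ → ℕ → ℕ) → Prop} {T N : ℕ}
    {c : Cmd} {x b : ℕ} (Inv : ℕ → (ℕ → ℕ) → (ℕ → ℕ → ℕ) → Prop) (hxb : b ≠ x) (hb : ρ b = N)
    (h0 : Inv 0 (update ρ x 0) A)
    (hstep : ∀ k < N, ∀ ρ' A', Inv k ρ' A' → ρ' x = k → ρ' b = N →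
      Run c T ρ' A' fun ρ'' A'' => ρ'' x = k ∧ ρ'' b = N ∧ Inv (k + 1) (update ρ'' x (k + 1)) A'')
    (hQ : ∀ ρ' A', Inv N ρ' A' → ρ' b = N → Q ρ' A') :
    Run (forLoop x b c) (forTime N T) ρ A Q := by
  have key : ∀ m k ρ' A', k + m = N → Inv k ρ' A' → ρ' x = k → ρ' b = N →
      Run (.loop (.sub (.reg b) (.reg x)) (.seq c (.assign x (.add (.reg x) (.const 1)))))
        (m * (T + 8) + 4) ρ' A' Q := by
    intro m
    induction m with
    | zero =>
      intro k ρ' A' hk hI hx hb t o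
      refine ⟨ρ', A', t + 4, ?_, by omega, hQ _ _ (by simpa [← hk] using hI) hb⟩
      exact Exec.loop_false (by simp [Expr.eval, hx, hb, ← hk])
    | succ m ih =>
      intro k ρ' A' hk hI hx hb t o
      obtain ⟨ρ₁, A₁, t₁, h1, h2, h3, h4, h5⟩ := hstep k (by omega) ρ' A' hI hx hb (t + 4) o
      obtain ⟨ρ₂, A₂, t₂, h6, h7, h8⟩ := ih (k + 1) (update ρ₁ x (k + 1)) A₁ (by omega) h5
        (by simp) (by rw [update_of_ne hxb, h4]) (t₁ + 4) o
      refine ⟨ρ₂, A₂, t₂, ?_, by rw [Nat.succ_mul]; omega, h8⟩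
      refine Exec.loop_true (s' := ⟨update ρ₁ x (k + 1), A₁, t₁ + 4, o⟩) ?_ (h1.seq ?_) h6
      · simp only [Expr.eval, hx, hb]
        omega
      · have := Exec.assign x (.add (.reg x) (.const 1)) ⟨ρ₁, A₁, t₁, o⟩
        simp only [Expr.eval, h3] at this
        exact this
  refine Run.mono (Run.seq (T' := N * (T + 8) + 4) (Run.assign ?_))
    (by simp only [forTime, Expr.cost]; omega) fun _ _ h => h
  exact key N 0 _ _ (by omega) h0 (by simp [Expr.ev]) (by rw [update_of_ne hxb, hb])

/-! ### First-order formulas and their evaluation by programs -/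

/-- The truth value of a proposition as a number. -/
noncomputable def bit (P : Prop) : ℕ := open Classical in if P then 1 else 0

theorem bit_true {P : Prop} (h : P) : bit P = 1 := by simp [bit, h]

theorem bit_false {P : Prop} (h : ¬ P) : bit P = 0 := by simp [bit, h]

@[simp] theorem bit_ne_zero {P : Prop} : bit P ≠ 0 ↔ P := by
  by_cases h : P <;> simp [bit, h]

@[simp] theorem bit_eq_zero {P : Prop} : bit P = 0 ↔ ¬ P := by
  by_cases h : P <;> simp [bit, h]

theorem bit_congr {P P' : Prop} (h : P ↔ P') : bit P = bit P' := by rw [propext h]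

/-- First-order formulas over the memory; `ex x b φ` quantifies the register `x` over the numbers
below the value of the register `b`. -/
inductive Fm : Type
  | nz (e : Expr)
  | and (φ ψ : Fm)
  | not (φ : Fm)
  | ex (x b : ℕ) (φ : Fm)

/-- Truth of a formula. -/
def Fm.Holds (A : ℕ → ℕ → ℕ) : Fm → (ℕ → ℕ) → Prop
  | nz e, ρ => e.ev ρ A ≠ 0
  | and φ ψ, ρ => φ.Holds A ρ ∧ ψ.Holds A ρ
  | not φ, ρ => ¬ φ.Holds A ρ
  | ex x b φ, ρ => ∃ k < ρ b, φ.Holds A (update ρ x k)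

/-- All registers of the expression are below `d`. -/
def Expr.WF (d : ℕ) : Expr → Prop
  | const _ => True
  | reg x => x < d
  | cell _ i => i.WF d
  | add e f => e.WF d ∧ f.WF d
  | sub e f => e.WF d ∧ f.WF d

/-- All registers of the formula are below `d`, and quantifiers are bounded by one of the registers
`0` and `2`, which are not themselves quantified. -/
def Fm.WF (d : ℕ) : Fm → Prop
  | nz e => e.WF d
  | and φ ψ => φ.WF d ∧ ψ.WF d
  | not φ => φ.WF d
  | ex x b φ => 2 < x ∧ x < d ∧ (b = 0 ∨ b = 2) ∧ φ.WF d

theorem Expr.WF.mono {d d' : ℕ} (hd : d ≤ d') {e : Expr} (h : e.WF d) : e.WF d' := by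
  induction e with
  | const => trivial
  | reg x => exact lt_of_lt_of_le (show x < d from h) hd
  | cell _ _ ih => exact ih h
  | add _ _ ih₁ ih₂ => exact ⟨ih₁ h.1, ih₂ h.2⟩
  | sub _ _ ih₁ ih₂ => exact ⟨ih₁ h.1, ih₂ h.2⟩

theorem Fm.WF.mono {d d' : ℕ} (hd : d ≤ d') {φ : Fm} (h : φ.WF d) : φ.WF d' := by
  induction φ with
  | nz e => exact Expr.WF.mono hd h
  | and _ _ ih₁ ih₂ => exact ⟨ih₁ h.1, ih₂ h.2⟩
  | not _ ih => exact ih h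
  | ex x b _ ih => exact ⟨h.1, h.2.1.trans_le hd, h.2.2.1, ih h.2.2.2⟩

theorem Expr.ev_congr {d : ℕ} {e : Expr} (h : e.WF d) {ρ ρ' : ℕ → ℕ} {A : ℕ → ℕ → ℕ}
    (hρ : ∀ x < d, ρ x = ρ' x) : e.ev ρ A = e.ev ρ' A := by
  induction e with
  | const => rfl
  | reg x => exact hρ x h
  | cell _ _ ih => simp only [Expr.ev, ih h]
  | add _ _ ih₁ ih₂ => simp only [Expr.ev, ih₁ h.1, ih₂ h.2]
  | sub _ _ ih₁ ih₂ => simp only [Expr.ev, ih₁ h.1, ih₂ h.2]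

theorem Fm.holds_congr {d : ℕ} (hd : 2 < d) {φ : Fm} (h : φ.WF d) {A : ℕ → ℕ → ℕ}
    {ρ ρ' : ℕ → ℕ} (hρ : ∀ x < d, ρ x = ρ' x) : φ.Holds A ρ ↔ φ.Holds A ρ' := by
  induction φ generalizing ρ ρ' with
  | nz e => simp only [Fm.Holds, Expr.ev_congr h hρ]
  | and _ _ ih₁ ih₂ => simp only [Fm.Holds, ih₁ h.1 hρ, ih₂ h.2 hρ]
  | not _ ih => simp only [Fm.Holds, ih h hρ]
  | ex x b φ ih =>
    obtain ⟨-, -, h3, h4⟩ := h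
    simp only [Fm.Holds]
    rw [hρ b (by omega)]
    refine exists_congr fun k => and_congr_right fun _ => ih h4 fun y hy => ?_
    by_cases hyx : y = x
    · subst hyx; simp
    · simp [hyx, hρ y hy]

/-- The program that stores the truth value of a formula in the register `d`. It changes no
register below `d`. -/
def Fm.comp : Fm → ℕ → Cmd
  | nz e, d => .cond e (.assign d (.const 1)) (.assign d (.const 0))
  | and φ ψ, d => .seq (φ.comp d) (.seq (ψ.comp (d + 1))
      (.cond (.reg d) (.assign d (.reg (d + 1))) .skip))
  | not φ, d => .seq (φ.comp d) (.assign d (.sub (.const 1) (.reg d)))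
  | ex x b φ, d => .seq (.assign d (.const 0)) (.seq (.assign (d + 1) (.reg x))
      (.seq (forLoop x b (.seq (φ.comp (d + 2)) (.cond (.reg (d + 2)) (.assign d (.const 1)) .skip)))
        (.assign x (.reg (d + 1)))))

/-- The time for the evaluation of a formula with quantifiers over at most `N` numbers. -/
def Fm.time (N : ℕ) : Fm → ℕ
  | nz e => e.cost + 3
  | and φ ψ => φ.time N + (ψ.time N + 4)
  | not φ => φ.time N + 4
  | ex _ _ φ => 2 + (2 + (forTime N (φ.time N + 4) + 2))

theorem forTime_mono {N N' T : ℕ} (h : N ≤ N') : forTime N T ≤ forTime N' T := by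
  unfold forTime
  gcongr

/-- Registers from `d` on serve as a stack: `d` receives the result, `d + 1` the second conjunct or
the saved value of a quantified register, and the body of a quantifier is evaluated from `d + 2` on.
-/
theorem Fm.run (φ : Fm) : ∀ {d : ℕ} {ρ : ℕ → ℕ} {A : ℕ → ℕ → ℕ} {N : ℕ}, φ.WF d → 2 < d →
    ρ 0 ≤ N → ρ 2 ≤ N → Run (φ.comp d) (φ.time N) ρ A fun ρ' A' =>
      A' = A ∧ (∀ x < d, ρ' x = ρ x) ∧ ρ' d = bit (φ.Holds A ρ) := by
  induction φ with
  | nz e =>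
    intro d ρ A N hwf hd h0 h2
    refine Run.mono (Run.cond (T := 2) (fun h => Run.assign ⟨rfl, fun x hx => ?_, ?_⟩)
      (fun h => Run.assign ⟨rfl, fun x hx => ?_, ?_⟩)) (by simp [Fm.time]) fun _ _ h => h
    · rw [update_of_ne (by omega)]
    · rw [update_self, bit_true (by exact h)]; rfl
    · rw [update_of_ne (by omega)]
    · rw [update_self, bit_false (by simpa [Fm.Holds] using h)]; rfl
  | not φ ih =>
    intro d ρ A N hwf hd h0 h2
    refine Run.mono (Run.seq (T' := 4) ((ih hwf hd h0 h2).imp ?_)) le_rfl fun _ _ h => h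
    rintro ρ' A' ⟨rfl, h, h'⟩
    refine Run.assign ⟨rfl, fun x hx => ?_, ?_⟩
    · rw [update_of_ne (by omega), h x hx]
    · by_cases hφ : φ.Holds A' ρ <;> simp [Expr.ev, h', Fm.Holds, hφ, bit]
  | and φ ψ ih₁ ih₂ =>
    intro d ρ A N hwf hd h0 h2
    refine Run.mono (Run.seq (T' := ψ.time N + 4) ((ih₁ hwf.1 hd h0 h2).imp ?_)) le_rfl
      fun _ _ h => h
    rintro ρ' A' ⟨rfl, h, h'⟩
    refine Run.seq (T' := 4) ((ih₂ (hwf.2.mono (Nat.le_succ d)) (by omega) (by rw [h 0 (by omega)]; exact h0)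
      (by rw [h 2 (by omega)]; exact h2)).imp ?_)
    rintro ρ'' A'' ⟨rfl, g, g'⟩
    have hψ : ψ.Holds A'' ρ' ↔ ψ.Holds A'' ρ := holds_congr hd hwf.2 h
    refine Run.cond (e := .reg d) (T := 2) (fun hc => Run.assign ⟨rfl, fun x hx => ?_, ?_⟩)
      (fun hc => Run.mono (Run.skip ⟨rfl, fun x hx => ?_, ?_⟩) (by omega) fun _ _ h => h)
    · rw [update_of_ne (by omega), g x (by omega), h x hx]
    · simp only [Expr.ev, g d (by omega), h', bit_ne_zero] at hc
      simp only [Expr.ev, update_self, g', Fm.Holds, hc, hψ, true_and]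
    · rw [g x (by omega), h x hx]
    · simp only [Expr.ev, g d (by omega), h', bit_eq_zero] at hc
      rw [g d (by omega), h', bit_false hc, bit_false]
      exact fun hn => hc hn.1
  | ex x b φ ih =>
    intro d ρ A N hwf hd h0 h2
    obtain ⟨hx2, hxd, hb, hwf⟩ := hwf
    have hbN : ρ b ≤ N := by rcases hb with rfl | rfl <;> assumption
    refine Run.mono (Run.seq (T' := 2 + (forTime N (φ.time N + 4) + 2)) (Run.assign
      (Run.seq (T' := forTime N (φ.time N + 4) + 2) (Run.assign
      (Run.seq (T' := 2) (Run.mono (Run.forLoop (T := φ.time N + 4) (N := ρ b)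
        (fun k ρ' A' => A' = A ∧ (∀ y < d, y ≠ x → ρ' y = ρ y) ∧ ρ' (d + 1) = ρ x ∧
          ρ' d = bit (∃ j < k, φ.Holds A (update ρ x j)))
        (by omega) ?_ ⟨rfl, ?_, ?_, ?_⟩ ?_ ?_) (forTime_mono hbN) fun _ _ h => h)))))) le_rfl fun _ _ h => h
    · rw [update_of_ne (by omega), update_of_ne (by omega)]
    · intro y hy hyx
      rw [update_of_ne hyx, update_of_ne (by omega), update_of_ne (by omega)]
    · rw [update_of_ne (by omega), update_self]
      simp [Expr.ev, show x ≠ d by omega]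
    · rw [update_of_ne (by omega), update_of_ne (by omega), update_self, bit_false (by simp)]
      rfl
    · rintro k hk ρ' A' ⟨rfl, g1, g2, g3⟩ hx hb'
      refine Run.seq ((ih (hwf.mono (by omega)) (by omega) (by rw [g1 0 (by omega) (by omega)]; exact h0)
        (by rw [g1 2 (by omega) (by omega)]; exact h2)).imp ?_)
      rintro ρ'' A'' ⟨rfl, f1, f2⟩
      have hφ : φ.Holds A'' ρ' ↔ φ.Holds A'' (update ρ x k) := by
        refine holds_congr hd hwf fun y hy => ?_
        by_cases hyx : y = x
        · subst hyx; simp [hx]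
        · rw [update_of_ne hyx, g1 y hy hyx]
      have hex : (∃ j < k + 1, φ.Holds A'' (update ρ x j)) ↔
          (∃ j < k, φ.Holds A'' (update ρ x j)) ∨ φ.Holds A'' (update ρ x k) := by
        simp only [Nat.lt_succ_iff_lt_or_eq, or_and_right, exists_or, exists_eq_left]
      refine Run.cond (e := .reg (d + 2)) (T := 2)
        (fun hc => Run.assign ⟨?_, ?_, rfl, fun y hy hyx => ?_, ?_, ?_⟩)
        (fun hc => Run.mono (Run.skip ⟨?_, ?_, rfl, fun y hy hyx => ?_, ?_, ?_⟩) (by omega)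
          fun _ _ h => h)
      · rw [update_of_ne (by omega), f1 x (by omega), hx]
      · rw [update_of_ne (by omega), f1 b (by omega), hb']
      · rw [update_of_ne hyx, update_of_ne (by omega), f1 y (by omega), g1 y hy hyx]
      · rw [update_of_ne (by omega), update_of_ne (by omega), f1 _ (by omega), g2]
      · simp only [Expr.ev, f2, bit_ne_zero] at hc
        rw [update_of_ne (by omega), update_self, bit_true (hex.2 (Or.inr (hφ.1 hc)))]
        rfl
      · rw [f1 x (by omega), hx]
      · rw [f1 b (by omega), hb']
      · rw [update_of_ne hyx, f1 y (by omega), g1 y hy hyx]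
      · rw [update_of_ne (by omega), f1 _ (by omega), g2]
      · simp only [Expr.ev, f2, bit_eq_zero] at hc
        rw [update_of_ne (by omega), f1 d (by omega), g3]
        refine bit_congr (hex.trans ?_).symm
        exact or_iff_left fun h => hc (hφ.2 h)
    · rintro ρ' A' ⟨rfl, g1, g2, g3⟩ hb'
      refine Run.assign ⟨rfl, fun y hy => ?_, ?_⟩
      · by_cases hyx : y = x
        · subst hyx; simp [Expr.ev, g2]
        · rw [update_of_ne hyx, g1 y hy hyx]
      · rw [update_of_ne (by omega), g3]
        rfl

/-! ### Polynomial time bounds -/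

/-- Functions given by polynomials. -/
def IsPoly (f : ℕ → ℕ) : Prop := ∃ p : Polynomial ℕ, ∀ n, f n = p.eval n

theorem IsPoly.const (k : ℕ) : IsPoly fun _ => k := ⟨.C k, by simp⟩

theorem IsPoly.id : IsPoly fun n => n := ⟨.X, by simp⟩

theorem IsPoly.add {f g : ℕ → ℕ} : IsPoly f → IsPoly g → IsPoly fun n => f n + g n := by
  rintro ⟨p, hp⟩ ⟨q, hq⟩
  exact ⟨p + q, by simp [hp, hq]⟩

theorem IsPoly.mul {f g : ℕ → ℕ} : IsPoly f → IsPoly g → IsPoly fun n => f n * g n := by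
  rintro ⟨p, hp⟩ ⟨q, hq⟩
  exact ⟨p * q, by simp [hp, hq]⟩

theorem IsPoly.comp {f g : ℕ → ℕ} : IsPoly f → IsPoly g → IsPoly fun n => f (g n) := by
  rintro ⟨p, hp⟩ ⟨q, hq⟩
  exact ⟨p.comp q, by simp [hp, hq]⟩

theorem IsPoly.forTime {f g : ℕ → ℕ} (hf : IsPoly f) (hg : IsPoly g) :
    IsPoly fun n => forTime (f n) (g n) :=
  (hf.mul (hg.add (.const 8))).add (.const 6)

theorem Fm.isPoly_time (φ : Fm) : IsPoly fun N => φ.time N := by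
  induction φ with
  | nz e => exact .const _
  | and φ ψ ih₁ ih₂ => exact ih₁.add (ih₂.add (.const _))
  | not φ ih => exact ih.add (.const _)
  | ex x b φ ih => exact .add (.const _) (.add (.const _) (.add (.forTime .id (ih.add (.const _))) (.const _)))

end RAM

/-! ### The formulas of the algorithm -/

namespace RAM

open Function SimpleGraph

namespace Fm

/-- Disjunction. -/
def or (φ ψ : Fm) : Fm := .not (.and (.not φ) (.not ψ))

/-- Bounded universal quantification. -/
def all (x b : ℕ) (φ : Fm) : Fm := .not (.ex x b (.not φ))

/-- Implication. -/
def imp (φ ψ : Fm) : Fm := .not (.and φ (.not ψ))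

/-- Comparison. -/
def lt (e f : Expr) : Fm := .nz (.sub f e)

/-- Equality. -/
def eq (e f : Expr) : Fm := .not (.nz (.add (.sub e f) (.sub f e)))

variable {A : ℕ → ℕ → ℕ} {ρ : ℕ → ℕ} {φ ψ : Fm} {e f : Expr} {x b d : ℕ}

theorem holds_nz : (nz e).Holds A ρ ↔ ¬ e.ev ρ A = 0 := Iff.rfl

theorem holds_and : (and φ ψ).Holds A ρ ↔ φ.Holds A ρ ∧ ψ.Holds A ρ := Iff.rfl

theorem holds_not : (not φ).Holds A ρ ↔ ¬ φ.Holds A ρ := Iff.rfl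

theorem holds_ex : (ex x b φ).Holds A ρ ↔ ∃ k < ρ b, φ.Holds A (update ρ x k) := Iff.rfl

theorem holds_or : (or φ ψ).Holds A ρ ↔ φ.Holds A ρ ∨ ψ.Holds A ρ := by
  simp only [or, Holds]; tauto

theorem holds_imp : (imp φ ψ).Holds A ρ ↔ (φ.Holds A ρ → ψ.Holds A ρ) := by
  simp only [imp, Holds]; tauto

theorem holds_all : (all x b φ).Holds A ρ ↔ ∀ k < ρ b, φ.Holds A (update ρ x k) := by
  simp [all, Holds]

theorem holds_lt : (lt e f).Holds A ρ ↔ e.ev ρ A < f.ev ρ A := by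
  simp only [lt, Holds, Expr.ev]; omega

theorem holds_eq : (eq e f).Holds A ρ ↔ e.ev ρ A = f.ev ρ A := by
  simp only [eq, Holds, Expr.ev]; omega

end Fm

/-- The number of a literal: `v` for `(v, true)` and `v + n` for `(v, false)`. -/
def enc {n : ℕ} (l : Lit (Fin n)) : ℕ := if l.2 = true then l.1 else l.1 + n

section enc

variable {n : ℕ} {l m : Lit (Fin n)} {v : Fin n}

@[simp] theorem enc_true : enc (v, true) = v := rfl

@[simp] theorem enc_false : enc (v, false) = v + n := rfl

theorem enc_lt (l : Lit (Fin n)) : enc l < 2 * n := by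
  obtain ⟨v, s⟩ := l
  have := v.2
  cases s <;> simp <;> omega

theorem enc_injective : Injective (enc (n := n)) := by
  rintro ⟨v, s⟩ ⟨w, t⟩ h
  have := v.2
  have := w.2
  cases s <;> cases t <;> simp only [enc_true, enc_false] at h <;>
    first | omega | (congr 1; ext; omega)

theorem exists_enc {k : ℕ} (hk : k < 2 * n) : ∃ l : Lit (Fin n), enc l = k := by
  by_cases h : k < n
  · exact ⟨(⟨k, h⟩, true), rfl⟩
  · exact ⟨(⟨k - n, by omega⟩, false), by simp; omega⟩

theorem exists_lt_enc_iff {P : ℕ → Prop} : (∃ k < 2 * n, P k) ↔ ∃ l : Lit (Fin n), P (enc l) := by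
  constructor
  · rintro ⟨k, hk, h⟩
    obtain ⟨l, rfl⟩ := exists_enc hk
    exact ⟨l, h⟩
  · rintro ⟨l, h⟩
    exact ⟨_, enc_lt l, h⟩

theorem forall_lt_enc_iff {P : ℕ → Prop} : (∀ k < 2 * n, P k) ↔ ∀ l : Lit (Fin n), P (enc l) := by
  constructor
  · exact fun h l => h _ (enc_lt l)
  · intro h k hk
    obtain ⟨l, rfl⟩ := exists_enc hk
    exact h l

theorem exists_lt_fin_iff {P : ℕ → Prop} : (∃ k < n, P k) ↔ ∃ v : Fin n, P v :=
  ⟨fun ⟨k, hk, h⟩ => ⟨⟨k, hk⟩, h⟩, fun ⟨v, h⟩ => ⟨v, v.2, h⟩⟩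

theorem enc_eq_val : enc l = v ↔ l = (v, true) := by
  rw [← enc_true, enc_injective.eq_iff]

theorem enc_eq_val_add : enc l = v + n ↔ l = (v, false) := by
  rw [← enc_false, enc_injective.eq_iff]

theorem enc_eq_enc : enc l = enc m ↔ l = m := enc_injective.eq_iff

theorem enc_eq_enc_add : enc l = enc m + n ∨ enc m = enc l + n ↔ m = l.neg := by
  obtain ⟨v, s⟩ := l
  obtain ⟨w, t⟩ := m
  have := v.2
  have := w.2
  cases s <;> cases t <;> simp [Fin.ext_iff] <;> omega

theorem enc_lt_iff : enc l < n ↔ l.2 = true := by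
  obtain ⟨v, s⟩ := l
  cases s <;> simp

end enc

/-- The contents of the arrays that describe the graph and the multiples used for addressing. -/
structure Tables {n : ℕ} (G : SimpleGraph (Fin n)) (A : ℕ → ℕ → ℕ) : Prop where
  adj : ∀ u v : Fin n, A 0 ((u : ℕ) * n + v) = bit (G.Adj u v)
  mul3 : ∀ x < 2 * n, A 3 x = x * n
  mul4 : ∀ x < 2 * n, A 4 x = x * (2 * n)
  mul5 : ∀ x < 2 * n, A 5 x = x * (2 * n * (2 * n))
  mul6 : ∀ x < 2 * n, A 6 x = x * (2 * n * (2 * n) * (2 * n))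

/-- The cell of a table indexed by two vertices and two literals. -/
def cell4 (t a b p q : ℕ) : Expr :=
  .cell t (.add (.cell 6 (.reg a)) (.add (.cell 5 (.reg b)) (.add (.cell 4 (.reg p)) (.reg q))))

/-- The array `t` tabulates the relation `W`. -/
def IsTable {n : ℕ} (A : ℕ → ℕ → ℕ) (t : ℕ)
    (W : Fin n → Fin n → Lit (Fin n) → Lit (Fin n) → Prop) : Prop :=
  ∀ (a b : Fin n) (l m : Lit (Fin n)), A t (A 6 ↑a + (A 5 ↑b + (A 4 (enc l) + enc m))) = bit (W a b l m)

open Fm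

/-- Adjacency of the vertices in two registers. -/
def adjF (x y : ℕ) : Fm := .nz (.cell 0 (.add (.cell 3 (.reg x)) (.reg y)))

theorem Tables.adj_eq_zero {n : ℕ} {G : SimpleGraph (Fin n)} {A : ℕ → ℕ → ℕ} (h : Tables G A)
    (u v : Fin n) : A 0 (A 3 u + v) = 0 ↔ ¬ G.Adj u v := by
  rw [h.mul3 _ (by omega), h.adj, bit_eq_zero]

/-- The literal `(x, true)` is forced. -/
def forcedF (a b x : ℕ) : Fm :=
  .or (.eq (.reg x) (.reg a))
    (.and (adjF a x) (.and (.not (.eq (.reg x) (.reg b))) (.not (adjF b x))))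

/-- The literal in `l` is `(x, true)`. -/
def posF (l x : ℕ) : Fm := .eq (.reg l) (.reg x)

/-- The literal in `l` is `(x, false)`. -/
def negF (l x : ℕ) : Fm := .eq (.reg l) (.add (.reg x) (.reg 0))

/-- The implications of the 2-SAT instance; the arguments are in the registers 10 to 13. -/
def impliesF : Fm :=
  .or (.eq (.reg 12) (.reg 13))
    (.or (.ex 20 0 (.or (.and (negF 12 20) (.and (posF 13 20) (forcedF 10 11 20)))
        (.and (posF 12 20) (.and (negF 13 20) (forcedF 11 10 20)))))
      (.ex 20 0 (.ex 21 0 (.ex 22 0 (.ex 23 0 (.and (adjF 20 21) (.and (adjF 22 23)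
        (.and (.or (.and (.not (.eq (.reg 20) (.reg 22))) (.not (adjF 20 22)))
          (.and (.not (.eq (.reg 21) (.reg 23))) (.not (adjF 21 23))))
        (.and (.or (posF 12 20) (.or (negF 13 20) (forcedF 10 11 20)))
        (.and (.or (negF 12 21) (.or (posF 13 21) (forcedF 11 10 21)))
        (.and (.or (posF 12 22) (.or (negF 13 22) (forcedF 10 11 22)))
          (.or (negF 12 23) (.or (posF 13 23) (forcedF 11 10 23))))))))))))))

theorem forced_mk_true {V : Type*} {G : SimpleGraph V} {a b x : V} : G.Forced a b (x, true) ↔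
    x = a ∨ (G.Adj a x ∧ ¬ x = b ∧ ¬ G.Adj b x) := by
  simp [Forced]

/-- This is the positive case with `a` and `b` exchanged, so `forcedF` with swapped arguments covers
it. -/
theorem forced_mk_false {V : Type*} {G : SimpleGraph V} {a b x : V} : G.Forced a b (x, false) ↔
    x = b ∨ (G.Adj b x ∧ ¬ x = a ∧ ¬ G.Adj a x) := by
  simp [Forced]

theorem eq_neg_mk_iff {V : Type*} {m : Lit V} {x : V} {s : Bool} :
    (x, s) = m.neg ↔ m = (x, !s) := by
  rw [← Lit.neg_mk]
  exact ⟨fun h => by rw [h, Lit.neg_neg], fun h => by rw [h, Lit.neg_neg]⟩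

theorem implies_iff {V : Type*} {G : SimpleGraph V} {a b : V} {l m : Lit V} :
    G.Implies a b l m ↔ l = m ∨
      (∃ x, (l = (x, false) ∧ m = (x, true) ∧ G.Forced a b (x, true)) ∨
        (l = (x, true) ∧ m = (x, false) ∧ G.Forced a b (x, false))) ∨
      ∃ x x' y y', G.Adj x x' ∧ G.Adj y y' ∧
        ((¬ x = y ∧ ¬ G.Adj x y) ∨ (¬ x' = y' ∧ ¬ G.Adj x' y')) ∧
        (l = (x, true) ∨ m = (x, false) ∨ G.Forced a b (x, true)) ∧
        (l = (x', false) ∨ m = (x', true) ∨ G.Forced a b (x', false)) ∧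
        (l = (y, true) ∨ m = (y, false) ∨ G.Forced a b (y, true)) ∧
        (l = (y', false) ∨ m = (y', true) ∨ G.Forced a b (y', false)) := by
  unfold Implies Clash
  refine or_congr_right (or_congr ?_ ?_)
  · obtain ⟨v, s⟩ := l
    obtain ⟨w, t⟩ := m
    cases s <;> cases t <;> simp [eq_comm]
  · simp only [eq_neg_mk_iff, Bool.not_true, Bool.not_false, ne_eq, eq_comm (b := l)]

section

variable {n : ℕ} {G : SimpleGraph (Fin n)} {A : ℕ → ℕ → ℕ} {ρ : ℕ → ℕ}

theorem holds_impliesF (hA : Tables G A) (h0 : ρ 0 = n) {a b : Fin n} {l m : Lit (Fin n)}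
    (ha : ρ 10 = a) (hb : ρ 11 = b) (hl : ρ 12 = enc l) (hm : ρ 13 = enc m) :
    impliesF.Holds A ρ ↔ G.Implies a b l m := by
  rw [implies_iff]
  simp only [impliesF, adjF, forcedF, posF, negF, holds_or, holds_and, holds_not, holds_nz, holds_ex,
    holds_eq, Expr.ev, update_apply, Nat.reduceEqDiff, if_true, if_false, h0, ha, hb, hl, hm,
    exists_lt_fin_iff, hA.adj_eq_zero, enc_eq_val, enc_eq_val_add, enc_eq_enc, Fin.val_inj, not_not,
    OfNat.zero_ne_ofNat, forced_mk_true, forced_mk_false]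

end

/-- One round of the closure: paths through the literal in register 9. -/
def stepF : Fm :=
  .or (.nz (cell4 8 10 11 12 13)) (.and (.nz (cell4 8 10 11 12 9)) (.nz (cell4 8 10 11 9 13)))

/-- The table in the array 9. -/
def copyF : Fm := .nz (cell4 9 10 11 12 13)

/-- The literals in `p` and `q` are complementary. -/
def complF (p q : ℕ) : Fm :=
  .or (.eq (.reg p) (.add (.reg q) (.reg 0))) (.eq (.reg q) (.add (.reg p) (.reg 0)))

/-- The literal in `p` is in the sample, is among the values already chosen for the vertices below
the value of register 5, or is the literal in register 6. -/
def prescribedF (p : ℕ) : Fm :=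
  .or (.nz (.cell 7 (.reg p)))
    (.or (.and (.lt (.reg p) (.reg 5)) (.nz (.cell 10 (.reg p))))
      (.or (.and (.not (.lt (.reg p) (.reg 0))) (.and (.lt (.sub (.reg p) (.reg 0)) (.reg 5))
          (.not (.nz (.cell 10 (.sub (.reg p) (.reg 0)))))))
        (.eq (.reg p) (.reg 6))))

/-- Some consistent halfspace contains the prescribed literals. -/
def extF : Fm :=
  .or (.all 22 2 (.imp (prescribedF 22) (.not (.lt (.reg 22) (.reg 0)))))
    (.or (.all 22 2 (.imp (prescribedF 22) (.lt (.reg 22) (.reg 0))))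
      (.ex 20 0 (.ex 21 0 (.and (adjF 20 21)
        (.and (.all 22 2 (.all 23 2 (.imp (complF 22 23)
            (.not (.and (.nz (cell4 8 20 21 22 23)) (.nz (cell4 8 20 21 23 22)))))))
          (.all 22 2 (.all 23 2 (.all 24 2 (.imp (prescribedF 22) (.imp (prescribedF 23)
            (.imp (complF 23 24) (.not (.nz (cell4 8 20 21 22 24))))))))))))))

/-! ### Correctness of the formulas -/

section

variable {n : ℕ} {G : SimpleGraph (Fin n)} {A : ℕ → ℕ → ℕ} {ρ : ℕ → ℕ}
  {W : Fin n → Fin n → Lit (Fin n) → Lit (Fin n) → Prop}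

theorem IsTable.eq_zero {t : ℕ} (h : IsTable A t W) (a b : Fin n) (l m : Lit (Fin n)) :
    A t (A 6 ↑a + (A 5 ↑b + (A 4 (enc l) + enc m))) = 0 ↔ ¬ W a b l m := by
  rw [h, bit_eq_zero]

theorem holds_stepF (hT : IsTable A 8 W) {a b : Fin n} {k l m : Lit (Fin n)}
    (hk : ρ 9 = enc k) (ha : ρ 10 = a) (hb : ρ 11 = b) (hl : ρ 12 = enc l) (hm : ρ 13 = enc m) :
    stepF.Holds A ρ ↔ W a b l m ∨ (W a b l k ∧ W a b k m) := by
  simp only [stepF, cell4, holds_or, holds_and, holds_nz, Expr.ev, hk, ha, hb, hl, hm, hT.eq_zero,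
    not_not]

theorem holds_copyF (hT : IsTable A 9 W) {a b : Fin n} {l m : Lit (Fin n)}
    (ha : ρ 10 = a) (hb : ρ 11 = b) (hl : ρ 12 = enc l) (hm : ρ 13 = enc m) :
    copyF.Holds A ρ ↔ W a b l m := by
  simp only [copyF, cell4, holds_nz, Expr.ev, ha, hb, hl, hm, hT.eq_zero, not_not]

/-- The literals prescribed by a sample, the first `i` values of `f`, and `k`. -/
def Prescribed (S : List (Fin n × Bool)) (f : ℕ → ℕ) (i : ℕ) (k l : Lit (Fin n)) : Prop :=
  l ∈ S ∨ ((l.1 : ℕ) < i ∧ (l.2 = true ↔ f l.1 ≠ 0)) ∨ l = k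

theorem holds_prescribedF {S : List (Fin n × Bool)} (hS : ∀ l : Lit (Fin n), A 7 (enc l) ≠ 0 ↔ l ∈ S)
    (h0 : ρ 0 = n) (h5 : ρ 5 ≤ n) {k : Lit (Fin n)} (h6 : ρ 6 = enc k) {p : ℕ} {l : Lit (Fin n)}
    (hp : ρ p = enc l) : (prescribedF p).Holds A ρ ↔ Prescribed S (A 10) (ρ 5) k l := by
  simp only [prescribedF, Prescribed, holds_or, holds_and, holds_not, holds_nz, holds_lt, holds_eq,
    Expr.ev, h0, h6, hp, enc_eq_enc]
  refine or_congr (hS l) ?_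
  rw [← or_assoc]
  refine or_congr_left ?_
  obtain ⟨v, s⟩ := l
  have := v.2
  cases s
  -- As register 5 is at most `n`, codes of negative literals never pass the test meant for positive
  -- ones.
  · simp [show ¬ (v : ℕ) + n < ρ 5 by omega]
  · simp

/-- The formula transcribes the right side of `exists_isMHalfspace_iff` for the prescribed literals,
with the closure read from array 8. -/
theorem holds_extF (hG : G.Connected) (hA : Tables G A)
    (hT : IsTable A 8 fun a b => Relation.TransGen (G.Implies a b))
    {S : List (Fin n × Bool)} (hS : ∀ l : Lit (Fin n), A 7 (enc l) ≠ 0 ↔ l ∈ S)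
    (h0 : ρ 0 = n) (h2 : ρ 2 = 2 * n) {i : ℕ} (h5 : ρ 5 = i) (hi : i ≤ n) {k : Lit (Fin n)}
    (h6 : ρ 6 = enc k) :
    extF.Holds A ρ ↔ ∃ H ∈ G.versionSpace S,
      (∀ v : Fin n, (v : ℕ) < i → (v ∈ H ↔ A 10 v ≠ 0)) ∧ k.Sat H := by
  have hpre : ∀ p ρ' l, ρ' 0 = n → ρ' 5 = i → ρ' 6 = enc k → ρ' p = enc l →
      ((prescribedF p).Holds A ρ' ↔ Prescribed S (A 10) i k l) := by
    intro p ρ' l h0 h5 h6 hp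
    rw [holds_prescribedF hS h0 (by omega) h6 hp, h5]
  have key : (∃ H ∈ G.versionSpace S,
      (∀ v : Fin n, (v : ℕ) < i → (v ∈ H ↔ A 10 v ≠ 0)) ∧ k.Sat H) ↔
      ∃ H, G.IsMHalfspace H ∧ ∀ l, Prescribed S (A 10) i k l → l.Sat H := by
    refine exists_congr fun H => ?_
    constructor
    · rintro ⟨⟨hH, h1⟩, h2, h3⟩
      refine ⟨hH, ?_⟩
      rintro l (hl | ⟨hl, hl'⟩ | rfl)
      · exact h1 l hl
      · exact (h2 l.1 hl).trans hl'.symm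
      · exact h3
    · rintro ⟨hH, h⟩
      refine ⟨⟨hH, fun l hl => h l (Or.inl hl)⟩, fun v hv => ?_, h k (Or.inr (Or.inr rfl))⟩
      by_cases hf : A 10 v = 0
      · have := h (v, false) (Or.inr (Or.inl ⟨hv, by simp [hf]⟩))
        simpa [hf] using this
      · have := h (v, true) (Or.inr (Or.inl ⟨hv, by simp [hf]⟩))
        simpa [hf] using this
  rw [key, exists_isMHalfspace_iff hG]
  simp only [extF, holds_or, holds_all, holds_imp, holds_not, holds_lt, holds_ex, holds_and, complF,
    holds_eq, holds_nz, adjF, cell4, Expr.ev, update_apply, Nat.reduceEqDiff, if_true, if_false,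
    h0, h2, OfNat.zero_ne_ofNat, exists_lt_fin_iff, forall_lt_enc_iff,
    hA.adj_eq_zero, hT.eq_zero, enc_eq_enc_add, enc_lt_iff, not_not]
  refine or_congr ?_ (or_congr ?_ (exists_congr fun a => exists_congr fun b =>
    and_congr_right fun _ => and_congr ?_ ?_))
  · refine forall_congr' fun l => ?_
    rw [hpre 22 _ l (by simpa) (by simpa) (by simpa) (by simp), Bool.not_eq_true]
  · refine forall_congr' fun l => ?_
    rw [hpre 22 _ l (by simpa) (by simpa) (by simpa) (by simp)]
  · simp
  · refine forall_congr' fun l => forall_congr' fun m => ?_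
    have h22 := fun k' : Lit (Fin n) => hpre 22 (update (update (update (update (update ρ 20 a) 21 b) 22 (enc l))
      23 (enc m)) 24 (enc k')) l (by simpa) (by simpa) (by simpa) (by simp)
    have h23 := fun k' : Lit (Fin n) => hpre 23 (update (update (update (update (update ρ 20 a) 21 b) 22 (enc l))
      23 (enc m)) 24 (enc k')) m (by simpa) (by simpa) (by simpa) (by simp)
    simp only [h22, h23]
    -- Register 24 is quantified only to name the complement of the literal in register 23.
    exact ⟨fun h h1 h2 => h _ h1 h2 rfl, fun h _ h1 h2 h3 => h3 ▸ h h1 h2⟩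

end

end RAM

/-! ### Tables, transitive closure and the preparation phase -/

namespace RAM

open Function SimpleGraph Fm

/-- From `A` to `A'`, only the array `t` changed, and only to values prescribed by `val`. -/
def Updates (t : ℕ) (val : ℕ → ℕ) (A A' : ℕ → ℕ → ℕ) : Prop :=
  (∀ a, a ≠ t → A' a = A a) ∧ ∀ j, A' t j = val j ∨ A' t j = A t j

theorem Updates.refl (t : ℕ) (val : ℕ → ℕ) (A : ℕ → ℕ → ℕ) : Updates t val A A :=
  ⟨fun _ _ => rfl, fun _ => Or.inr rfl⟩

theorem Updates.trans {t : ℕ} {val : ℕ → ℕ} {A A' A'' : ℕ → ℕ → ℕ} (h : Updates t val A A')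
    (h' : Updates t val A' A'') : Updates t val A A'' := by
  refine ⟨fun a ha => (h'.1 a ha).trans (h.1 a ha), fun j => ?_⟩
  rcases h'.2 j with h1 | h1
  · exact Or.inl h1
  · rw [h1]; exact h.2 j

theorem Updates.eq_val {t : ℕ} {val : ℕ → ℕ} {A A' : ℕ → ℕ → ℕ} (h : Updates t val A A') {j : ℕ}
    (hj : A t j = val j) : A' t j = val j := by
  rcases h.2 j with h1 | h1
  · exact h1
  · rw [h1, hj]

/-- A rule for nested loops filling a table, where `D k j` says that round `k` is responsible for
cell `j`. Since any change to a cell sets it to its value under `val`, later rounds cannot spoil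
earlier ones. -/
theorem Run.forLoop_updates {ρ : ℕ → ℕ} {A : ℕ → ℕ → ℕ} {T N : ℕ} {c : Cmd} {x b t : ℕ}
    {val : ℕ → ℕ} (D : ℕ → ℕ → Prop) (hbx : b < x) (hb : ρ b = N)
    (hstep : ∀ k < N, ∀ ρ' A', (∀ y < x, ρ' y = ρ y) → ρ' x = k → Updates t val A A' →
      Run c T ρ' A' fun ρ'' A'' => (∀ y < x + 1, ρ'' y = ρ' y) ∧ Updates t val A' A'' ∧
        ∀ j, D k j → A'' t j = val j) :
    Run (RAM.forLoop x b c) (forTime N T) ρ A fun ρ' A' => (∀ y < x, ρ' y = ρ y) ∧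
      Updates t val A A' ∧ ∀ j, (∃ k < N, D k j) → A' t j = val j := by
  refine Run.forLoop (fun k ρ' A' => (∀ y < x, ρ' y = ρ y) ∧ Updates t val A A' ∧
    ∀ j, (∃ k' < k, D k' j) → A' t j = val j) (by omega) hb
    ⟨fun y hy => update_of_ne (by omega) _ _, .refl t val A, by simp⟩ ?_ fun ρ' A' h _ => h
  rintro k hk ρ' A' ⟨h1, h2, h3⟩ hx hb'
  refine (hstep k hk ρ' A' h1 hx h2).imp ?_
  rintro ρ'' A'' ⟨g1, g2, g3⟩
  refine ⟨by rw [g1 x (by omega), hx], by rw [g1 b (by omega), hb'], fun y hy => ?_, h2.trans g2, ?_⟩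
  · rw [update_of_ne (by omega), g1 y (by omega), h1 y hy]
  · rintro j ⟨k', hk', hD⟩
    rcases Nat.lt_succ_iff_lt_or_eq.1 hk' with h | rfl
    · exact g2.eq_val (h3 j ⟨k', h, hD⟩)
    · exact g3 j hD

/-- Tabulates a formula with the arguments in the registers 10 to 13 in the array `t`. -/
def tab4 (t : ℕ) (φ : Fm) : Cmd :=
  forLoop 10 0 (forLoop 11 0 (forLoop 12 2 (forLoop 13 2 (.seq (φ.comp 50)
    (.store t (.add (.cell 6 (.reg 10)) (.add (.cell 5 (.reg 11))
      (.add (.cell 4 (.reg 12)) (.reg 13)))) (.reg 50))))))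

/-- The time for tabulating a formula. -/
def tab4Time (φ : Fm) (N : ℕ) : ℕ :=
  forTime N (forTime N (forTime N (forTime N (φ.time N + 12))))

theorem forTime_mono_right {N T T' : ℕ} (h : T ≤ T') : forTime N T ≤ forTime N T' := by
  unfold forTime
  gcongr

theorem eq_and_eq_of_mul_add_eq {M x x' r r' : ℕ} (hr : r < M) (hr' : r' < M)
    (h : x * M + r = x' * M + r') : x = x' ∧ r = r' := by
  have hM : 0 < M := by omega
  have h1 := congrArg (· / M) h
  have h2 := congrArg (· % M) h
  simp only [Nat.mul_add_mod_self_right, Nat.mod_eq_of_lt hr, Nat.mod_eq_of_lt hr'] at h2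
  rw [Nat.add_comm, Nat.add_comm (x' * M)] at h
  simp only [Nat.add_comm _ r, Nat.add_comm _ r', Nat.add_mul_div_right _ _ hM,
    Nat.div_eq_of_lt hr, Nat.div_eq_of_lt hr', Nat.zero_add] at h1
  exact ⟨h1, h2⟩

/-! ### Filling tables and Warshall's algorithm -/

section

variable {n : ℕ} {G : SimpleGraph (Fin n)} {A : ℕ → ℕ → ℕ} {ρ : ℕ → ℕ}

/-- The address is a four-digit number in base `2 * n`. -/
theorem Tables.index_injective (hA : Tables G A) {a b a' b' : Fin n} {l m l' m' : Lit (Fin n)}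
    (h : A 6 a + (A 5 b + (A 4 (enc l) + enc m)) = A 6 a' + (A 5 b' + (A 4 (enc l') + enc m'))) :
    a = a' ∧ b = b' ∧ l = l' ∧ m = m' := by
  have hl := enc_lt l
  have hm := enc_lt m
  have hl' := enc_lt l'
  have hm' := enc_lt m'
  rw [hA.mul6 a (by omega), hA.mul6 a' (by omega), hA.mul5 b (by omega), hA.mul5 b' (by omega),
    hA.mul4 _ hl, hA.mul4 _ hl'] at h
  have step : ∀ {x M r : ℕ}, x < 2 * n → r < M → x * M + r < 2 * n * M := by
    intro x M r hx hr
    calc x * M + r < x * M + M := by omega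
      _ = (x + 1) * M := by ring
      _ ≤ 2 * n * M := Nat.mul_le_mul_right _ hx
  have s1 := step hl hm
  have s1' := step hl' hm'
  have s2 := (step (show (b : ℕ) < 2 * n by omega) s1).trans_eq (Nat.mul_assoc _ _ _).symm
  have s2' := (step (show (b' : ℕ) < 2 * n by omega) s1').trans_eq (Nat.mul_assoc _ _ _).symm
  obtain ⟨e1, h⟩ := eq_and_eq_of_mul_add_eq s2 s2' h
  obtain ⟨e2, h⟩ := eq_and_eq_of_mul_add_eq s1 s1' h
  obtain ⟨e3, e4⟩ := eq_and_eq_of_mul_add_eq hm hm' h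
  exact ⟨Fin.ext e1, Fin.ext e2, enc_injective e3, enc_injective e4⟩

/-- Evaluation alternates with writing to `t`, so `hφ` asks for correctness whatever array `t`
contains. In effect the formula must not depend on the table being filled. -/
theorem run_tab4 {t : ℕ} {φ : Fm} (hwf : φ.WF 50) (hA : Tables G A) (ht : 6 < t) (h0 : ρ 0 = n)
    (h2 : ρ 2 = 2 * n) {W : Fin n → Fin n → Lit (Fin n) → Lit (Fin n) → Prop}
    (hφ : ∀ (ρ' : ℕ → ℕ) (A' : ℕ → ℕ → ℕ) (a b : Fin n) (l m : Lit (Fin n)), (∀ y < 10, ρ' y = ρ y) →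
      (∀ a', a' ≠ t → A' a' = A a') → ρ' 10 = a → ρ' 11 = b → ρ' 12 = enc l → ρ' 13 = enc m →
      (φ.Holds A' ρ' ↔ W a b l m)) :
    Run (tab4 t φ) (tab4Time φ (2 * n)) ρ A fun ρ' A' => (∀ y < 10, ρ' y = ρ y) ∧
      (∀ a', a' ≠ t → A' a' = A a') ∧ IsTable A' t W := by
  set val : ℕ → ℕ := fun j => bit (∃ (a b : Fin n) (l m : Lit (Fin n)),
    j = A 6 a + (A 5 b + (A 4 (enc l) + enc m)) ∧ W a b l m) with hval
  have hval' : ∀ (a b : Fin n) (l m : Lit (Fin n)),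
      val (A 6 a + (A 5 b + (A 4 (enc l) + enc m))) = bit (W a b l m) := by
    intro a b l m
    refine bit_congr ⟨?_, fun h => ⟨a, b, l, m, rfl, h⟩⟩
    rintro ⟨a', b', l', m', h, hW⟩
    obtain ⟨rfl, rfl, rfl, rfl⟩ := hA.index_injective h
    exact hW
  refine Run.mono (Run.forLoop_updates (t := t) (val := val) (T := forTime n (forTime (2 * n)
    (forTime (2 * n) (φ.time (2 * n) + 12)))) (fun k j => ∃ (a b : Fin n) (l m : Lit (Fin n)),
      (a : ℕ) = k ∧ j = A 6 a + (A 5 b + (A 4 (enc l) + enc m)))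
    (by omega) h0 ?_) ?_ ?_
  rotate_left
  · exact (forTime_mono (by omega)).trans (forTime_mono_right (forTime_mono (by omega)))
  · rintro ρ' A' ⟨h1, h2, h3⟩
    refine ⟨h1, h2.1, fun a b l m => ?_⟩
    rw [h2.1 4 (by omega), h2.1 5 (by omega), h2.1 6 (by omega), h3 _ ⟨a, a.2, a, b, l, m, rfl, rfl⟩,
      hval']
  intro ka hka ρ₁ A₁ e₁ x₁ u₁
  refine (Run.forLoop_updates (t := t) (val := val) (fun k j => ∃ (b : Fin n) (l m : Lit (Fin n)),
    (b : ℕ) = k ∧ j = A 6 ka + (A 5 b + (A 4 (enc l) + enc m))) (by omega)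
    (by rw [e₁ 0 (by omega), h0]) ?_).imp ?_
  rotate_left
  · rintro ρ' A' ⟨h1, h2, h3⟩
    refine ⟨h1, h2, ?_⟩
    rintro j ⟨a, b, l, m, ha, hj⟩
    exact h3 j ⟨b, b.2, b, l, m, rfl, by rw [hj, ha]⟩
  intro kb hkb ρ₂ A₂ e₂ x₂ u₂
  refine (Run.forLoop_updates (t := t) (val := val) (fun k j => ∃ (l m : Lit (Fin n)),
    enc l = k ∧ j = A 6 ka + (A 5 kb + (A 4 (enc l) + enc m))) (by omega)
    (by rw [e₂ 2 (by omega), e₁ 2 (by omega), h2]) ?_).imp ?_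
  rotate_left
  · rintro ρ' A' ⟨h1, h2, h3⟩
    refine ⟨h1, h2, ?_⟩
    rintro j ⟨b, l, m, hb, hj⟩
    exact h3 j ⟨enc l, enc_lt l, l, m, rfl, by rw [hj, hb]⟩
  intro kl hkl ρ₃ A₃ e₃ x₃ u₃
  refine (Run.forLoop_updates (t := t) (val := val) (fun k j => ∃ (m : Lit (Fin n)),
    enc m = k ∧ j = A 6 ka + (A 5 kb + (A 4 kl + enc m))) (by omega)
    (by rw [e₃ 2 (by omega), e₂ 2 (by omega), e₁ 2 (by omega), h2]) ?_).imp ?_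
  rotate_left
  · rintro ρ' A' ⟨h1, h2, h3⟩
    refine ⟨h1, h2, ?_⟩
    rintro j ⟨l, m, hl, hj⟩
    exact h3 j ⟨enc m, enc_lt m, m, rfl, by rw [hj, hl]⟩
  intro km hkm ρ₄ A₄ e₄ x₄ u₄
  obtain ⟨l, rfl⟩ := exists_enc hkl
  obtain ⟨m, rfl⟩ := exists_enc hkm
  have y₁ : ρ₄ 10 = ka := by rw [e₄ 10 (by omega), e₃ 10 (by omega), e₂ 10 (by omega), x₁]
  have y₂ : ρ₄ 11 = kb := by rw [e₄ 11 (by omega), e₃ 11 (by omega), x₂]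
  have y₃ : ρ₄ 12 = enc l := by rw [e₄ 12 (by omega), x₃]
  have y₀ : ∀ y < 10, ρ₄ y = ρ y := fun y hy => by
    rw [e₄ y (by omega), e₃ y (by omega), e₂ y (by omega), e₁ y (by omega)]
  have u : Updates t val A A₄ := u₁.trans (u₂.trans (u₃.trans u₄))
  refine Run.seq ((φ.run hwf (by omega) (by rw [y₀ 0 (by omega), h0]; omega)
    (by rw [y₀ 2 (by omega), h2])).imp ?_)
  rintro ρ' A' ⟨rfl, hρ, hd⟩
  rw [hφ ρ₄ A' ⟨ka, hka⟩ ⟨kb, hkb⟩ l m y₀ u.1 y₁ y₂ y₃ x₄, ← hval'] at hd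
  have hidx : Expr.ev ρ' A' (.add (.cell 6 (.reg 10)) (.add (.cell 5 (.reg 11))
      (.add (.cell 4 (.reg 12)) (.reg 13)))) = A 6 ka + (A 5 kb + (A 4 (enc l) + enc m)) := by
    simp only [Expr.ev, hρ 10 (by omega), hρ 11 (by omega), hρ 12 (by omega), hρ 13 (by omega), y₁,
      y₂, y₃, x₄, u.1 6 (by omega), u.1 5 (by omega), u.1 4 (by omega)]
  apply Run.store
  refine ⟨fun y hy => hρ y (by omega), ⟨fun a ha => update_of_ne ha _ _, fun j => ?_⟩, ?_⟩
  · rw [update_self, hidx]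
    by_cases hj : j = A 6 ka + (A 5 kb + (A 4 (enc l) + enc m))
    · left
      rw [hj, update_self]
      exact hd
    · right
      rw [update_of_ne hj]
  · rintro j ⟨m', hm', rfl⟩
    rw [hm', update_self, hidx, update_self]
    exact hd

/-! #### Transitive closure -/

/-- The relation reached after `k` rounds of the closure algorithm. -/
def warshall (r : Lit (Fin n) → Lit (Fin n) → Prop) : ℕ → Lit (Fin n) → Lit (Fin n) → Prop
  | 0, l, m => r l m
  | k + 1, l, m => warshall r k l m ∨ ∃ x, enc x = k ∧ warshall r k l x ∧ warshall r k x m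

/-- Chains may be joined at any literal already processed. If `x` is the newest one, both chains
come from the previous round up to a detour at `x` itself. If both pass through the newest literal
elsewhere, the part between the two visits is dropped. -/
theorem warshall_trans (r : Lit (Fin n) → Lit (Fin n) → Prop) (k : ℕ) {x l m : Lit (Fin n)}
    (hx : enc x < k) (h : warshall r k l x) (h' : warshall r k x m) : warshall r k l m := by
  induction k generalizing x l m with
  | zero => omega
  | succ k ih =>
    by_cases hk : enc x = k
    · have hl : warshall r k l x := by
        rcases h with h | ⟨y, hy, h1, -⟩
        · exact h
        · rwa [enc_injective (hk.trans hy.symm)]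
      have hm : warshall r k x m := by
        rcases h' with h | ⟨y, hy, -, h1⟩
        · exact h
        · rwa [enc_injective (hk.trans hy.symm)]
      exact Or.inr ⟨x, hk, hl, hm⟩
    · have hx' : enc x < k := by omega
      rcases h with h | ⟨y, hy, h1, h2⟩ <;> rcases h' with h' | ⟨z, hz, h1', h2'⟩
      · exact Or.inl (ih hx' h h')
      · exact Or.inr ⟨z, hz, ih hx' h h1', h2'⟩
      · exact Or.inr ⟨y, hy, h1, ih hx' h2 h'⟩
      · obtain rfl := enc_injective (hy.trans hz.symm)
        exact Or.inr ⟨y, hy, h1, h2'⟩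

theorem warshall_iff_transGen (r : Lit (Fin n) → Lit (Fin n) → Prop) {l m : Lit (Fin n)} :
    warshall r (2 * n) l m ↔ Relation.TransGen r l m := by
  have mono : ∀ k {l m}, r l m → warshall r k l m := by
    intro k
    induction k with
    | zero => exact fun h => h
    | succ k ih => exact fun h => Or.inl (ih h)
  constructor
  · generalize 2 * n = k
    intro h
    induction k generalizing l m with
    | zero => exact .single h
    | succ k ih =>
      rcases h with h | ⟨x, -, h1, h2⟩
      · exact ih h
      · exact (ih h1).trans (ih h2)
  · intro h
    induction h with
    | single h => exact mono _ h
    | tail _ h ih => exact warshall_trans r _ (enc_lt _) ih (mono _ h)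

/-- Computes the transitive closures of the implications for all edges. -/
def closureCmd : Cmd :=
  .seq (tab4 8 impliesF) (forLoop 9 2 (.seq (tab4 9 stepF) (tab4 8 copyF)))

/-- The time for computing the transitive closures. -/
def closureTime (N : ℕ) : ℕ :=
  tab4Time impliesF N + forTime N (tab4Time stepF N + tab4Time copyF N)

theorem wf_impliesF : impliesF.WF 50 := by
  simp [impliesF, Fm.WF, Fm.or, Fm.eq, adjF, posF, negF, forcedF, Expr.WF]

theorem wf_stepF : stepF.WF 50 := by
  simp [stepF, Fm.WF, Fm.or, cell4, Expr.WF]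

theorem wf_copyF : copyF.WF 50 := by
  simp [copyF, Fm.WF, cell4, Expr.WF]

theorem wf_extF : extF.WF 50 := by
  simp [extF, Fm.WF, Fm.or, Fm.eq, Fm.lt, Fm.all, Fm.imp, adjF, complF, prescribedF, cell4, Expr.WF]

theorem Tables.of_eq (hA : Tables G A) {A' : ℕ → ℕ → ℕ} (h : ∀ a < 7, A' a = A a) :
    Tables G A' := by
  constructor
  · rw [h 0 (by omega)]; exact hA.adj
  · rw [h 3 (by omega)]; exact hA.mul3
  · rw [h 4 (by omega)]; exact hA.mul4
  · rw [h 5 (by omega)]; exact hA.mul5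
  · rw [h 6 (by omega)]; exact hA.mul6

theorem IsTable.of_eq {t : ℕ} {W : Fin n → Fin n → Lit (Fin n) → Lit (Fin n) → Prop}
    (hT : IsTable A t W) {A' : ℕ → ℕ → ℕ} (h : ∀ a < 7, A' a = A a) (ht : A' t = A t) :
    IsTable A' t W := by
  intro a b l m
  rw [ht, h 6 (by omega), h 5 (by omega), h 4 (by omega)]
  exact hT a b l m

/-- Each round reads array 8, writes array 9 and copies back, so that it works on an unchanging
relation as `run_tab4` demands. -/
theorem run_closureCmd (hA : Tables G A) (h0 : ρ 0 = n) (h2 : ρ 2 = 2 * n) :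
    Run closureCmd (closureTime (2 * n)) ρ A fun ρ' A' => (∀ y < 9, ρ' y = ρ y) ∧
      (∀ a, a ≠ 8 → a ≠ 9 → A' a = A a) ∧
      IsTable A' 8 fun a b => Relation.TransGen (G.Implies a b) := by
  refine Run.seq ((run_tab4 wf_impliesF hA (by omega) h0 h2
    (W := fun a b => G.Implies a b) ?_).imp ?_)
  · intro ρ' A' a b l m e u ha hb hl hm
    exact holds_impliesF (hA.of_eq fun a ha => u a (by omega)) (by rw [e 0 (by omega), h0]) ha hb hl hm
  rintro ρ₁ A₁ ⟨e₁, u₁, T₁⟩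
  refine Run.forLoop (fun k ρ' A' => (∀ y < 9, ρ' y = ρ y) ∧ (∀ a, a ≠ 8 → a ≠ 9 → A' a = A a) ∧
    IsTable A' 8 fun a b => warshall (G.Implies a b) k) (by omega) (by rw [e₁ 2 (by omega), h2])
    ⟨fun y hy => ?_, fun a h8 _ => u₁ a h8, T₁⟩ ?_ ?_
  · rw [update_of_ne (by omega), e₁ y (by omega)]
  · rintro k hk ρ₂ A₂ ⟨e₂, u₂, T₂⟩ hx hb
    obtain ⟨x, rfl⟩ := exists_enc hk
    refine Run.seq ((run_tab4 wf_stepF (hA.of_eq fun a ha => u₂ a (by omega) (by omega)) (by omega)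
      (by rw [e₂ 0 (by omega), h0]) hb
      (W := fun a b => warshall (G.Implies a b) (enc x + 1)) ?_).imp ?_)
    · intro ρ' A' a b l m e u ha hb hl hm
      rw [holds_stepF (k := x) (T₂.of_eq (fun a ha => u a (by omega)) (u 8 (by omega)))
        (by rw [e 9 (by omega), hx]) ha hb hl hm]
      simp only [warshall, enc_eq_enc, exists_eq_left]
    rintro ρ₃ A₃ ⟨e₃, u₃, T₃⟩
    refine (run_tab4 wf_copyF (hA.of_eq fun a ha => ?_) (by omega)
      (by rw [e₃ 0 (by omega), e₂ 0 (by omega), h0]) (by rw [e₃ 2 (by omega), hb])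
      (W := fun a b => warshall (G.Implies a b) (enc x + 1)) ?_).imp ?_
    · rw [u₃ a (by omega), u₂ a (by omega) (by omega)]
    · intro ρ' A' a b l m e u ha hb hl hm
      exact holds_copyF (T₃.of_eq (fun a ha => u a (by omega)) (u 9 (by omega))) ha hb hl hm
    rintro ρ₄ A₄ ⟨e₄, u₄, T₄⟩
    refine ⟨by rw [e₄ 9 (by omega), e₃ 9 (by omega), hx], by rw [e₄ 2 (by omega), e₃ 2 (by omega), hb],
      fun y hy => ?_, fun a h8 h9 => ?_, T₄⟩
    · rw [update_of_ne (by omega), e₄ y (by omega), e₃ y (by omega), e₂ y hy]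
    · rw [u₄ a h8, u₃ a h9, u₂ a h8 h9]
  · rintro ρ' A' ⟨e, u, T⟩ _
    refine ⟨e, u, ?_⟩
    intro a b l m
    rw [T]
    exact bit_congr (warshall_iff_transGen _)

end

/-! #### Multiplication tables and the sample -/

/-- Fills the array `t` with the multiples of the value of the register `r`. -/
def mulTable (t r : ℕ) : Cmd :=
  forLoop 9 2 (.store t (.add (.reg 9) (.const 1)) (.add (.cell t (.reg 9)) (.reg r)))

/-- Multiples arise by repeated addition. The range includes `x = N`: with `N = 2 * n`, that last
cell provides the next power of `2 * n` to `prepare`. -/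
theorem run_mulTable {ρ : ℕ → ℕ} {A : ℕ → ℕ → ℕ} {t r N k : ℕ} (hr : r ≠ 9) (h2 : ρ 2 = N)
    (hk : ρ r = k) (ht : A t 0 = 0) : Run (mulTable t r) (forTime N 8) ρ A fun ρ' A' =>
      (∀ y, y ≠ 9 → ρ' y = ρ y) ∧ (∀ a, a ≠ t → A' a = A a) ∧ ∀ x ≤ N, A' t x = x * k := by
  refine Run.forLoop (fun i ρ' A' => (∀ y, y ≠ 9 → ρ' y = ρ y) ∧ (∀ a, a ≠ t → A' a = A a) ∧
    ∀ x ≤ i, A' t x = x * k) (by omega) h2 ⟨fun y hy => update_of_ne hy _ _, fun _ _ => rfl, ?_⟩ ?_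
    fun _ _ h _ => h
  · intro x hx
    obtain rfl : x = 0 := by omega
    rw [ht, Nat.zero_mul]
  · rintro i hi ρ' A' ⟨e, u, h⟩ hx hb
    refine Run.store ⟨hx, hb, fun y hy => ?_, fun a ha => ?_, fun x hx' => ?_⟩
    · rw [update_of_ne hy, e y hy]
    · rw [update_of_ne ha, u a ha]
    · simp only [update_self, Expr.ev, hx, e r hr, hk]
      by_cases hxi : x = i + 1
      · rw [hxi, update_self, h i le_rfl, Nat.succ_mul]
      · rw [update_of_ne hxi, h x (by omega)]

/-- Marks the literals of the sample in the array 7. -/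
def readSample : Cmd :=
  forLoop 9 1 (.cond (.cell 2 (.reg 9)) (.store 7 (.cell 1 (.reg 9)) (.const 1))
    (.store 7 (.add (.cell 1 (.reg 9)) (.reg 0)) (.const 1)))

theorem run_readSample {n : ℕ} {S : List (Fin n × Bool)} {ρ : ℕ → ℕ} {A : ℕ → ℕ → ℕ} (h0 : ρ 0 = n)
    (h1 : ρ 1 = S.length) (hA1 : A 1 = fun k => (S.map fun e => (e.1 : ℕ)).getD k 0)
    (hA2 : A 2 = fun k => (S.map fun e => e.2.toNat).getD k 0) (hA7 : A 7 = fun _ => 0) :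
    Run readSample (forTime S.length 9) ρ A fun ρ' A' => (∀ y, y ≠ 9 → ρ' y = ρ y) ∧
      (∀ a, a ≠ 7 → A' a = A a) ∧ ∀ l : Lit (Fin n), A' 7 (enc l) ≠ 0 ↔ l ∈ S := by
  refine Run.forLoop (fun i ρ' A' => (∀ y, y ≠ 9 → ρ' y = ρ y) ∧ (∀ a, a ≠ 7 → A' a = A a) ∧
    ∀ l : Lit (Fin n), A' 7 (enc l) ≠ 0 ↔ l ∈ S.take i) (by omega) h1
    ⟨fun y hy => update_of_ne hy _ _, fun _ _ => rfl, fun l => by simp [hA7]⟩ ?_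
    fun ρ' A' h _ => by simpa only [List.take_length] using h
  rintro i hi ρ' A' ⟨e, u, h⟩ hx hb
  have hadd : ∀ k, k = enc S[i] → ∀ l : Lit (Fin n),
      update A' 7 (update (A' 7) k 1) 7 (enc l) ≠ 0 ↔ l ∈ S.take (i + 1) := by
    rintro k rfl l
    rw [update_self, List.take_add_one, List.mem_append, ← h l, List.getElem?_eq_getElem hi]
    by_cases hl : l = S[i]
    · simp [hl]
    · rw [update_of_ne (fun h => hl (enc_injective h))]
      simp [hl]
  have hv : A' 1 i = (S[i].1 : ℕ) := by
    rw [u 1 (by omega), hA1]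
    simp [hi]
  have hs : A' 2 i = S[i].2.toNat := by
    rw [u 2 (by omega), hA2]
    simp [hi]
  refine Run.cond (e := .cell 2 (.reg 9)) (T := 6)
    (fun hc => Run.mono (Run.store (i := .cell 1 (.reg 9)) (e := .const 1)
      ⟨hx, hb, fun y hy => ?_, fun a ha => ?_, ?_⟩) (by simp [Expr.cost]) fun _ _ h => h)
    (fun hc => Run.mono (Run.store (i := .add (.cell 1 (.reg 9)) (.reg 0)) (e := .const 1)
      ⟨hx, hb, fun y hy => ?_, fun a ha => ?_, ?_⟩) (by simp [Expr.cost]) fun _ _ h => h)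
  · rw [update_of_ne hy, e y hy]
  · rw [update_of_ne ha, u a ha]
  · refine hadd _ ?_
    simp only [Expr.ev, hx, hs] at hc
    have : S[i].2 = true := by
      cases h : S[i].2 <;> simp_all
    simp only [Expr.ev, hx, hv, enc, this, if_true]
  · rw [update_of_ne hy, e y hy]
  · rw [update_of_ne ha, u a ha]
  · refine hadd _ ?_
    simp only [Expr.ev, hx, hs] at hc
    have : S[i].2 = false := by
      cases h : S[i].2 <;> simp_all
    simp [Expr.ev, hx, hv, enc, this, e 0, h0]

/-- The preparation phase: addressing tables, sample, and transitive closures. -/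
def prepare : Cmd :=
  .seq readSample (.seq (.assign 2 (.add (.reg 0) (.reg 0))) (.seq (mulTable 3 0)
    (.seq (mulTable 4 2) (.seq (.assign 3 (.cell 4 (.reg 2))) (.seq (mulTable 5 3)
      (.seq (.assign 3 (.cell 5 (.reg 2))) (.seq (mulTable 6 3) closureCmd)))))))

/-- The time for the preparation phase, apart from reading the sample. -/
def prepareTime (N : ℕ) : ℕ :=
  4 + (forTime N 8 + (forTime N 8 + (3 + (forTime N 8 + (3 + (forTime N 8 + closureTime N))))))

/-- The memory after the preparation phase. -/
structure Prepared {n : ℕ} (G : SimpleGraph (Fin n)) (S : List (Fin n × Bool)) (ρ : ℕ → ℕ)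
    (A : ℕ → ℕ → ℕ) : Prop where
  reg0 : ρ 0 = n
  reg2 : ρ 2 = 2 * n
  tables : Tables G A
  closure : IsTable A 8 fun a b => Relation.TransGen (G.Implies a b)
  sample : ∀ l : Lit (Fin n), A 7 (enc l) ≠ 0 ↔ l ∈ S

theorem run_prepare {n : ℕ} (G : SimpleGraph (Fin n)) (S : List (Fin n × Bool)) :
    Run prepare (forTime S.length 9 + prepareTime (2 * n)) (inputState G S).reg (inputState G S).arr
      fun ρ A => Prepared G S ρ A ∧ ρ 5 = 0 ∧ ρ 7 = 0 ∧ ∀ j, A 10 j ≤ 1 := by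
  set ρ := (inputState G S).reg with hρ
  set A := (inputState G S).arr with hA
  have hz : ∀ a, 3 ≤ a → A a = fun _ => 0 := by
    intro a ha
    obtain ⟨k, rfl⟩ : ∃ k, a = k + 3 := ⟨a - 3, by omega⟩
    rfl
  have hadj : ∀ u v : Fin n, A 0 ((u : ℕ) * n + v) = bit (G.Adj u v) := by
    intro u v
    by_cases huv : G.Adj u v
    · rw [bit_true huv]
      exact if_pos ⟨u, v, huv, rfl⟩
    · rw [bit_false huv]
      refine if_neg ?_
      rintro ⟨u', v', h, he⟩
      obtain ⟨h1, h2⟩ := eq_and_eq_of_mul_add_eq v.2 v'.2 he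
      rw [Fin.ext h1, Fin.ext h2] at huv
      exact huv h
  refine Run.seq ((run_readSample (S := S) rfl rfl rfl rfl (hz 7 (by omega))).imp ?_)
  rintro ρ₁ A₁ ⟨e₁, u₁, hS⟩
  refine Run.seq (Run.assign ?_)
  have hev : Expr.ev ρ₁ A₁ (.add (.reg 0) (.reg 0)) = 2 * n := by
    have : ρ₁ 0 = n := e₁ 0 (by omega)
    simp only [Expr.ev, this]
    omega
  rw [hev]
  have e₂ : ∀ y, y ≠ 9 → y ≠ 2 → update ρ₁ 2 (2 * n) y = ρ y := fun y h h' => by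
    rw [update_of_ne h', e₁ y h]
  refine Run.seq ((run_mulTable (k := n) (by omega) (update_self _ _ _) (e₂ 0 (by omega) (by omega))
    (by rw [u₁ 3 (by omega), hz 3 (by omega)])).imp ?_)
  rintro ρ₃ A₃ ⟨e₃, u₃, m₃⟩
  have h2₃ : ρ₃ 2 = 2 * n := by rw [e₃ 2 (by omega), update_self]
  refine Run.seq ((run_mulTable (k := 2 * n) (by omega) h2₃ h2₃
    (by rw [u₃ 4 (by omega), u₁ 4 (by omega), hz 4 (by omega)])).imp ?_)
  rintro ρ₄ A₄ ⟨e₄, u₄, m₄⟩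
  have h2₄ : ρ₄ 2 = 2 * n := by rw [e₄ 2 (by omega), h2₃]
  refine Run.seq (Run.assign ?_)
  rw [show Expr.ev ρ₄ A₄ (.cell 4 (.reg 2)) = 2 * n * (2 * n) by
    simp only [Expr.ev, h2₄, m₄ _ le_rfl]]
  refine Run.seq ((run_mulTable (N := 2 * n) (k := 2 * n * (2 * n)) (by omega)
    (by rw [update_of_ne (by omega), h2₄]) (update_self _ _ _)
    (by rw [u₄ 5 (by omega), u₃ 5 (by omega), u₁ 5 (by omega), hz 5 (by omega)])).imp ?_)
  rintro ρ₅ A₅ ⟨e₅, u₅, m₅⟩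
  have h2₅ : ρ₅ 2 = 2 * n := by rw [e₅ 2 (by omega), update_of_ne (by omega), h2₄]
  refine Run.seq (Run.assign ?_)
  rw [show Expr.ev ρ₅ A₅ (.cell 5 (.reg 2)) = 2 * n * (2 * n) * (2 * n) by
    simp only [Expr.ev, h2₅, m₅ _ le_rfl]; ring]
  refine Run.seq ((run_mulTable (N := 2 * n) (k := 2 * n * (2 * n) * (2 * n)) (by omega)
    (by rw [update_of_ne (by omega), h2₅]) (update_self _ _ _)
    (by rw [u₅ 6 (by omega), u₄ 6 (by omega), u₃ 6 (by omega), u₁ 6 (by omega), hz 6 (by omega)])).imp ?_)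
  rintro ρ₆ A₆ ⟨e₆, u₆, m₆⟩
  have hreg : ∀ y, y ≠ 9 → y ≠ 2 → y ≠ 3 → ρ₆ y = ρ y := fun y h h' h'' => by
    rw [e₆ y h, update_of_ne h'', e₅ y h, update_of_ne h'', e₄ y h, e₃ y h, e₂ y h h']
  have h2₆ : ρ₆ 2 = 2 * n := by rw [e₆ 2 (by omega), update_of_ne (by omega), h2₅]
  have hT : Tables G A₆ := by
    constructor
    · rw [u₆ 0 (by omega), u₅ 0 (by omega), u₄ 0 (by omega), u₃ 0 (by omega), u₁ 0 (by omega)]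
      exact hadj
    · rw [u₆ 3 (by omega), u₅ 3 (by omega), u₄ 3 (by omega)]
      exact fun x hx => m₃ x hx.le
    · rw [u₆ 4 (by omega), u₅ 4 (by omega)]
      exact fun x hx => m₄ x hx.le
    · rw [u₆ 5 (by omega)]
      exact fun x hx => m₅ x hx.le
    · exact fun x hx => m₆ x hx.le
  refine (run_closureCmd hT (hreg 0 (by omega) (by omega) (by omega)) h2₆).imp ?_
  rintro ρ₇ A₇ ⟨e₇, u₇, T₇⟩
  refine ⟨⟨?_, ?_, hT.of_eq fun a ha => u₇ a (by omega) (by omega), T₇, ?_⟩, ?_, ?_, fun j => ?_⟩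
  · rw [e₇ 0 (by omega), hreg 0 (by omega) (by omega) (by omega)]; rfl
  · rw [e₇ 2 (by omega), h2₆]
  · rw [u₇ 7 (by omega) (by omega), u₆ 7 (by omega), u₅ 7 (by omega), u₄ 7 (by omega), u₃ 7 (by omega)]
    exact hS
  · rw [e₇ 5 (by omega), hreg 5 (by omega) (by omega) (by omega)]; rfl
  · rw [e₇ 7 (by omega), hreg 7 (by omega) (by omega) (by omega)]; rfl
  · rw [u₇ 10 (by omega) (by omega), u₆ 10 (by omega), u₅ 10 (by omega), u₄ 10 (by omega),
      u₃ 10 (by omega), u₁ 10 (by omega), hz 10 (by omega)]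
    exact Nat.zero_le 1

end RAM

/-! ### Enumeration in lexicographic order -/

namespace RAM

open Function SimpleGraph Fm

section Remaining

variable {n : ℕ}

/-- The set `H` contains exactly those vertices below `k` at which `f` does not vanish. -/
def AgreesBelow (H : Set (Fin n)) (f : ℕ → ℕ) (k : ℕ) : Prop :=
  ∀ v : Fin n, (v : ℕ) < k → (v ∈ H ↔ f v ≠ 0)

/-- The members of `F` that first differ from `f` in the vertex `i`, which they contain. -/
def Exceeds (F : Set (Set (Fin n))) (f : ℕ → ℕ) (i : Fin n) (H : Set (Fin n)) : Prop :=
  H ∈ F ∧ f i = 0 ∧ AgreesBelow H f i ∧ i ∈ H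

/-- The members of `F` that extend the first `k` values of `f` or exceed them lexicographically. -/
def Remaining (F : Set (Set (Fin n))) (f : ℕ → ℕ) (k : ℕ) : Set (Set (Fin n)) :=
  {H | (H ∈ F ∧ AgreesBelow H f k) ∨ ∃ i : Fin n, (i : ℕ) < k ∧ Exceeds F f i H}

theorem AgreesBelow.congr {H : Set (Fin n)} {f g : ℕ → ℕ} {k : ℕ} (h : AgreesBelow H f k)
    (hfg : ∀ j < k, g j = f j) : AgreesBelow H g k := fun v hv => by
  rw [hfg v hv]
  exact h v hv

theorem AgreesBelow.mono {H : Set (Fin n)} {f : ℕ → ℕ} {k k' : ℕ} (h : AgreesBelow H f k)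
    (hk : k' ≤ k) : AgreesBelow H f k' := fun v hv => h v (by omega)

theorem remaining_zero (F : Set (Set (Fin n))) (f : ℕ → ℕ) : Remaining F f 0 = F := by
  ext H
  simp [Remaining, AgreesBelow]

/-- After the lexicographically first extension `H₀`, the sets exceeding it remain. -/
theorem mem_remaining_iff {F : Set (Set (Fin n))} {f f' : ℕ → ℕ} {k : ℕ} {H₀ : Set (Fin n)}
    (h₀ : H₀ ∈ F) (hH₀ : AgreesBelow H₀ f' n) (hff' : ∀ j < k, f' j = f j)
    (hmin : ∀ i : Fin n, k ≤ i → f' i ≠ 0 → ∀ H ∈ F, AgreesBelow H f' i → i ∈ H)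
    (H : Set (Fin n)) : H ∈ Remaining F f k ↔ H = H₀ ∨ ∃ i, Exceeds F f' i H := by
  constructor
  · intro hH
    by_contra hn
    push Not at hn
    rcases hH with ⟨hF, hH⟩ | ⟨i, hi, hF, hfi, hH, hiH⟩
    · refine hn.1 ?_
      -- If `H` exceeds `f'` nowhere, it agrees with `f'` everywhere: at a first disagreement beyond
      -- `k`, either `H` exceeds `f'` there or it contradicts the minimality `hmin`.
      have key : ∀ j : ℕ, ∀ v : Fin n, (v : ℕ) = j → (v ∈ H ↔ f' v ≠ 0) := by
        intro j
        induction j using Nat.strong_induction_on with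
        | _ j ih =>
          rintro v rfl
          have hb : AgreesBelow H f' v := fun w hw => ih w hw w rfl
          by_cases hv : (v : ℕ) < k
          · rw [hff' v hv]
            exact hH v hv
          · refine ⟨fun hvH hfv => hn.2 v ⟨hF, hfv, hb, hvH⟩, fun hfv => ?_⟩
            exact hmin v (by omega) hfv H hF hb
      ext v
      rw [key v v rfl, hH₀ v v.2]
    · exact hn.2 i ⟨hF, by rw [hff' i hi, hfi], hH.congr fun j hj => hff' j (by omega), hiH⟩
  · rintro (rfl | ⟨i, hF, hfi, hH, hiH⟩)
    · exact Or.inl ⟨h₀, fun v hv => by rw [← hff' v hv]; exact hH₀ v v.2⟩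
    · by_cases hi : (i : ℕ) < k
      · exact Or.inr ⟨i, hi, hF, by rw [← hff' i hi, hfi],
          hH.congr fun j hj => (hff' j (by omega)).symm, hiH⟩
      · exact Or.inl ⟨hF, (hH.mono (by omega)).congr fun j hj => (hff' j hj).symm⟩

/-- Backtracking without a stack: sets exceeding at `i₀` become extensions of the new prefix, sets
exceeding earlier stay recorded by the unchanged zeros below `i₀`, and by `hmax` there are none
later. -/
theorem exists_exceeds_iff {F : Set (Set (Fin n))} {f : ℕ → ℕ} {i₀ : Fin n} (h0 : f i₀ = 0)
    (hmax : ∀ i : Fin n, i₀ < i → ∀ H, ¬ Exceeds F f i H) (H : Set (Fin n)) :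
    (∃ i, Exceeds F f i H) ↔ H ∈ Remaining F (update f i₀ 1) (i₀ + 1) := by
  have hupd : ∀ j < (i₀ : ℕ), update f i₀ 1 j = f j := fun j hj => update_of_ne (by omega) _ _
  constructor
  · rintro ⟨i, hi⟩
    rcases lt_trichotomy i i₀ with h | rfl | h
    · have h : (i : ℕ) < i₀ := h
      exact Or.inr ⟨i, by omega, hi.1, by rw [hupd i h, hi.2.1],
        hi.2.2.1.congr fun j hj => hupd j (by omega), hi.2.2.2⟩
    · refine Or.inl ⟨hi.1, fun v hv => ?_⟩
      by_cases hvi : v = i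
      · subst hvi
        simp [hi.2.2.2]
      · have : (v : ℕ) ≠ i := fun h => hvi (Fin.ext h)
        rw [hupd v (by omega)]
        exact hi.2.2.1 v (by omega)
    · exact absurd hi (hmax i h H)
  · rintro (⟨hF, hH⟩ | ⟨i, hi, hF, hfi, hH, hiH⟩)
    · exact ⟨i₀, hF, h0, (hH.mono (by omega)).congr fun j hj => (hupd j hj).symm,
        (hH i₀ (by omega)).2 (by simp)⟩
    · have hne : (i : ℕ) ≠ i₀ := by
        intro h
        rw [h] at hfi
        simp at hfi
      exact ⟨i, hF, by rw [← hupd i (by omega), hfi],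
        hH.congr fun j hj => (hupd j (by omega)).symm, hiH⟩

end Remaining

/-! ### Greedy completion and successor search -/

theorem Prepared.of_eq {n : ℕ} {G : SimpleGraph (Fin n)} {S : List (Fin n × Bool)} {ρ ρ' : ℕ → ℕ}
    {A A' : ℕ → ℕ → ℕ} (h : Prepared G S ρ A) (h0 : ρ' 0 = ρ 0) (h2 : ρ' 2 = ρ 2)
    (hA : ∀ a, a ≠ 10 → A' a = A a) : Prepared G S ρ' A' where
  reg0 := h0.trans h.reg0
  reg2 := h2.trans h.reg2
  tables := h.tables.of_eq fun a ha => hA a (by omega)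
  closure := h.closure.of_eq (fun a ha => hA a (by omega)) (hA 8 (by omega))
  sample := by rw [hA 7 (by omega)]; exact h.sample

/-- Fixes the values of the vertices from register 7 on, taking 0 whenever possible. -/
def completeCmd : Cmd :=
  forLoop 5 0 (.cond (.sub (.add (.reg 5) (.const 1)) (.reg 7))
    (.seq (.assign 6 (.add (.reg 5) (.reg 0))) (.seq (extF.comp 50)
      (.store 10 (.reg 5) (.sub (.const 1) (.reg 50))))) .skip)

/-- The time for `completeCmd`. -/
def completeTime (N : ℕ) : ℕ := forTime N (6 + (4 + (extF.time N + 5)))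

/-- Looks for the last vertex at which the current set can be exceeded, and prepares the
enumeration of the sets that do so. Register 4 tells whether there is one. -/
def nextCmd : Cmd :=
  .seq (.assign 4 (.const 0)) (.seq
    (forLoop 5 0 (.seq (.assign 6 (.reg 5))
      (.seq ((Fm.and (.not (.nz (.cell 10 (.reg 5)))) extF).comp 50)
        (.cond (.reg 50) (.seq (.assign 4 (.const 1)) (.assign 8 (.reg 5))) .skip))))
    (.cond (.reg 4) (.seq (.store 10 (.reg 8) (.const 1))
      (.assign 7 (.add (.reg 8) (.const 1)))) .skip))

/-- The time for `nextCmd`. -/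
def nextTime (N : ℕ) : ℕ :=
  2 + (forTime N (2 + ((Fm.and (.not (.nz (.cell 10 (.reg 5)))) extF).time N + 6)) + 9)

section

variable {n : ℕ} {G : SimpleGraph (Fin n)} {S : List (Fin n × Bool)} {ρ : ℕ → ℕ}
  {A : ℕ → ℕ → ℕ}

theorem Prepared.holds_extF (h : Prepared G S ρ A) (hG : G.Connected) {i : ℕ} (h5 : ρ 5 = i)
    (hi : i ≤ n) {k : Lit (Fin n)} (h6 : ρ 6 = enc k) :
    extF.Holds A ρ ↔ ∃ H ∈ G.versionSpace S, AgreesBelow H (A 10) i ∧ k.Sat H :=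
  RAM.holds_extF hG h.tables h.closure h.sample h.reg0 h.reg2 h5 hi h6

/-- The greedy choice keeps the prefix extendable, and a vertex gets `1` only when no consistent
halfspace with the same prefix omits it. Hence the result is the lexicographically first extension.
-/
theorem run_completeCmd (hG : G.Connected) (hP : Prepared G S ρ A) {k : ℕ} (h7 : ρ 7 = k)
    (hbit : ∀ j, A 10 j ≤ 1) (hex : ∃ H ∈ G.versionSpace S, AgreesBelow H (A 10) k) :
    Run completeCmd (completeTime (2 * n)) ρ A fun ρ' A' => Prepared G S ρ' A' ∧
      (∀ j, A' 10 j ≤ 1) ∧ (∀ j < k, A' 10 j = A 10 j) ∧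
      (∃ H ∈ G.versionSpace S, AgreesBelow H (A' 10) n) ∧
      ∀ i : Fin n, k ≤ i → A' 10 i ≠ 0 → ∀ H ∈ G.versionSpace S, AgreesBelow H (A' 10) i → i ∈ H := by
  refine Run.mono (Run.forLoop (N := n) (T := 6 + (4 + (extF.time (2 * n) + 5)))
    (fun m ρ' A' => (∀ y < 5, ρ' y = ρ y) ∧ ρ' 7 = k ∧ (∀ a, a ≠ 10 → A' a = A a) ∧
      (∀ j, A' 10 j ≤ 1) ∧ (∀ j < k, A' 10 j = A 10 j) ∧
      (∃ H ∈ G.versionSpace S, AgreesBelow H (A' 10) (max m k)) ∧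
      ∀ i : Fin n, k ≤ i → i < m → A' 10 i ≠ 0 → ∀ H ∈ G.versionSpace S,
        AgreesBelow H (A' 10) i → i ∈ H)
    (by omega) hP.reg0 ⟨fun y hy => update_of_ne (by omega) _ _, ?_, fun _ _ => rfl, hbit,
      fun _ _ => rfl, by simpa using hex, by omega⟩ ?_ ?_) (forTime_mono (by omega)) fun _ _ h => h
  · rw [update_of_ne (by omega), h7]
  · rintro m hm ρ₁ A₁ ⟨e, h7, u, hb, hk, ⟨H₁, hH₁, hA₁⟩, hmin⟩ hx h0
    -- The test `m + 1 - k ≠ 0` means `k ≤ m`; rounds below `k` leave the given prefix alone, which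
    -- is why the invariant speaks of `max m k`.
    refine Run.cond (e := .sub (.add (.reg 5) (.const 1)) (.reg 7)) (fun hc => ?_) (fun hc =>
      Run.mono (Run.skip ⟨hx, h0, fun y hy => ?_, ?_, u, hb, hk, ⟨H₁, hH₁, hA₁.mono ?_⟩,
        fun i hi him => hmin i hi ?_⟩) (by omega) fun _ _ h => h)
    · simp only [Expr.ev, hx, h7] at hc
      rw [max_eq_left (by omega)] at hA₁
      refine Run.seq (Run.assign (Run.seq ?_))
      have hP₁ : Prepared G S (update ρ₁ 6 (Expr.ev ρ₁ A₁ (.add (.reg 5) (.reg 0)))) A₁ :=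
        hP.of_eq (by rw [update_of_ne (by omega), e 0 (by omega)])
          (by rw [update_of_ne (by omega), e 2 (by omega)]) u
      have hext := hP₁.holds_extF hG (i := m) (k := (⟨m, hm⟩, false))
        (by rw [update_of_ne (by omega), hx]) (by omega)
        (by rw [update_self]; simp only [Expr.ev, hx, h0]; rfl)
      refine (extF.run wf_extF (by omega) (by rw [hP₁.reg0]; omega) (by rw [hP₁.reg2])).imp ?_
      rintro ρ₂ A₂ ⟨rfl, e₂, hd⟩
      rw [bit_congr hext] at hd
      have hx₂ : ρ₂ 5 = m := by rw [e₂ 5 (by omega), update_of_ne (by omega), hx]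
      have hne : ∀ j, j ≠ m → update (A₂ 10) m (1 - ρ₂ 50) j = A₂ 10 j :=
        fun j hj => update_of_ne hj _ _
      refine Run.store (i := .reg 5) (e := .sub (.const 1) (.reg 50)) ⟨hx₂, ?_, fun y hy => ?_, ?_,
        fun a ha => ?_, ?_⟩
      · rw [e₂ 0 (by omega), update_of_ne (by omega), h0]
      · rw [update_of_ne (by omega), e₂ y (by omega), update_of_ne (by omega), e y hy]
      · rw [update_of_ne (by omega), e₂ 7 (by omega), update_of_ne (by omega), h7]
      · rw [update_of_ne ha, u a ha]
      simp only [update_self, Expr.ev, hx₂]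
      have hbelow : ∀ H : Set (Fin n), ∀ i ≤ m, AgreesBelow H (update (A₂ 10) m (1 - ρ₂ 50)) i ↔
          AgreesBelow H (A₂ 10) i := fun H i hi =>
        ⟨fun h => h.congr fun j hj => (hne j (by omega)).symm,
          fun h => h.congr fun j hj => hne j (by omega)⟩
      refine ⟨fun j => ?_, fun j hj => ?_, ?_, fun i hki him hfi H hH hHi => ?_⟩
      · by_cases hj : j = m
        · rw [hj, update_self]; omega
        · rw [hne j hj]; exact hb j
      · rw [hne j (by omega), hk j hj]
      · rw [max_eq_left (by omega)]
        by_cases hz : ∃ H ∈ G.versionSpace S, AgreesBelow H (A₂ 10) m ∧ Lit.Sat H (⟨m, hm⟩, false)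
        · obtain ⟨H, hH, hHm, hHs⟩ := id hz
          refine ⟨H, hH, fun v hv => ?_⟩
          by_cases hvm : (v : ℕ) = m
          · obtain rfl : v = ⟨m, hm⟩ := Fin.ext hvm
            rw [Lit.sat_mk_false] at hHs
            have h1 : ρ₂ 50 = 1 := by rw [hd, bit_true hz]
            simp [hHs, h1]
          · exact (hbelow H m le_rfl).2 hHm v (by omega)
        -- When `0` is impossible, the old witness itself must contain `m`.
        · refine ⟨H₁, hH₁, fun v hv => ?_⟩
          by_cases hvm : (v : ℕ) = m
          · obtain rfl : v = ⟨m, hm⟩ := Fin.ext hvm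
            have : (⟨m, hm⟩ : Fin n) ∈ H₁ := by
              by_contra hn
              exact hz ⟨H₁, hH₁, hA₁, (Lit.sat_mk_false _ _).2 hn⟩
            have h1 : ρ₂ 50 = 0 := by rw [hd, bit_false hz]
            simp [this, h1]
          · exact (hbelow H₁ m le_rfl).2 hA₁ v (by omega)
      · rw [hbelow H i (by omega)] at hHi
        by_cases him' : (i : ℕ) = m
        · obtain rfl : i = ⟨m, hm⟩ := Fin.ext him'
          by_contra hn
          have hz : ∃ H ∈ G.versionSpace S, AgreesBelow H (A₂ 10) m ∧
            Lit.Sat H (⟨m, hm⟩, false) := ⟨H, hH, hHi, (Lit.sat_mk_false _ _).2 hn⟩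
          rw [update_self, hd, bit_true hz] at hfi
          exact hfi rfl
        · rw [hne i him'] at hfi
          exact hmin i hki (by omega) hfi H hH hHi
    · rw [update_of_ne (by omega), e y hy]
    · rw [update_of_ne (by omega), h7]
    · simp only [Expr.ev, hx, h7] at hc
      omega
    · simp only [Expr.ev, hx, h7] at hc
      omega
  · rintro ρ' A' ⟨e, -, u, hb, hk, ⟨H, hH, hA⟩, hmin⟩ -
    exact ⟨hP.of_eq (e 0 (by omega)) (e 2 (by omega)) u, hb, hk, ⟨H, hH, hA.mono (by omega)⟩,
      fun i hi => hmin i hi i.2⟩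

/-- The scan is upward and overwrites register 8 at every success, so that register ends with the
last position that can be raised. -/
theorem run_nextCmd (hG : G.Connected) (hP : Prepared G S ρ A) :
    Run nextCmd (nextTime (2 * n)) ρ A fun ρ' A' => Prepared G S ρ' A' ∧
      ((ρ' 4 = 0 ∧ ∀ i H, ¬ Exceeds (G.versionSpace S) (A 10) i H) ∨
      (ρ' 4 ≠ 0 ∧ ∃ i₀ : Fin n, A 10 i₀ = 0 ∧ (∃ H, Exceeds (G.versionSpace S) (A 10) i₀ H) ∧
        (∀ i, i₀ < i → ∀ H, ¬ Exceeds (G.versionSpace S) (A 10) i H) ∧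
        A' 10 = update (A 10) i₀ 1 ∧ ρ' 7 = i₀ + 1)) := by
  refine Run.seq (Run.assign (Run.seq (Run.mono (Run.forLoop (N := n)
    (T := 2 + ((Fm.and (.not (.nz (.cell 10 (.reg 5)))) extF).time (2 * n) + 6))
    (fun m ρ' A' => (∀ y < 4, ρ' y = ρ y) ∧ A' = A ∧
      ((ρ' 4 = 0 ∧ ∀ i : Fin n, i < m → ∀ H, ¬ Exceeds (G.versionSpace S) (A 10) i H) ∨
      (ρ' 4 ≠ 0 ∧ ∃ i₀ : Fin n, ρ' 8 = i₀ ∧ (∃ H, Exceeds (G.versionSpace S) (A 10) i₀ H) ∧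
        (∀ i : Fin n, i₀ < i → i < m → ∀ H, ¬ Exceeds (G.versionSpace S) (A 10) i H))))
    (by omega) ?_ ⟨fun y hy => ?_, rfl, Or.inl ⟨?_, by omega⟩⟩ ?_ ?_) (forTime_mono (by omega))
      fun _ _ h => h)))
  · rw [update_of_ne (by omega), hP.reg0]
  · rw [update_of_ne (by omega), update_of_ne (by omega)]
  · rw [update_of_ne (by omega), update_self]; rfl
  · rintro m hm ρ₁ A₁ ⟨e, rfl, hI⟩ hx h0
    refine Run.seq (Run.assign (Run.seq ?_))
    have hP₁ : Prepared G S (update ρ₁ 6 (Expr.ev ρ₁ A₁ (.reg 5))) A₁ :=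
      hP.of_eq (by rw [update_of_ne (by omega), e 0 (by omega)])
        (by rw [update_of_ne (by omega), e 2 (by omega)]) fun _ _ => rfl
    have hext := hP₁.holds_extF hG (i := m) (k := (⟨m, hm⟩, true))
      (by rw [update_of_ne (by omega), hx]) (by omega)
      (by rw [update_self]; simp only [Expr.ev, hx]; rfl)
    have hall : (Fm.and (.not (.nz (.cell 10 (.reg 5)))) extF).Holds A₁
        (update ρ₁ 6 (Expr.ev ρ₁ A₁ (.reg 5))) ↔
        ∃ H, Exceeds (G.versionSpace S) (A₁ 10) ⟨m, hm⟩ H := by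
      rw [holds_and, hext, holds_not, holds_nz, not_not]
      simp only [Expr.ev, update_of_ne (show (5 : ℕ) ≠ 6 by omega), hx, Exceeds, Lit.sat_mk_true]
      exact ⟨fun ⟨h1, H, h2, h3, h4⟩ => ⟨H, h2, h1, h3, h4⟩,
        fun ⟨H, h2, h1, h3, h4⟩ => ⟨h1, H, h2, h3, h4⟩⟩
    have hwf : (Fm.and (.not (.nz (.cell 10 (.reg 5)))) extF).WF 50 :=
      ⟨by simp [Fm.WF, Expr.WF], wf_extF⟩
    refine (Fm.run _ hwf (by omega)
      (by rw [hP₁.reg0]; omega) (by rw [hP₁.reg2])).imp ?_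
    rintro ρ₂ A₂ ⟨rfl, e₂, hd⟩
    rw [bit_congr hall] at hd
    have e₃ : ∀ y < 50, y ≠ 6 → ρ₂ y = ρ₁ y := fun y hy h6 => by
      rw [e₂ y hy, update_of_ne h6]
    refine Run.cond (e := .reg 50) (T := 4)
      (fun hc => Run.seq (Run.assign (Run.assign ⟨?_, ?_, fun y hy => ?_, rfl, ?_⟩)))
      (fun hc => Run.mono (Run.skip ⟨?_, ?_, fun y hy => ?_, rfl, ?_⟩) (by omega) fun _ _ h => h)
    · simp [e₃, hx]
    · simp [e₃, h0]
    · rw [update_of_ne (by omega), update_of_ne (by omega), update_of_ne (by omega),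
        e₃ y (by omega) (by omega), e y hy]
    · simp only [Expr.ev, hd, bit_ne_zero] at hc
      refine Or.inr ⟨by simp [Expr.ev], ⟨m, hm⟩, by simp [Expr.ev, e₃, hx], hc, ?_⟩
      intro i h1 h2
      have h1 : m < (i : ℕ) := h1
      omega
    · rw [e₃ 5 (by omega) (by omega), hx]
    · rw [e₃ 0 (by omega) (by omega), h0]
    · rw [update_of_ne (by omega), e₃ y (by omega) (by omega), e y hy]
    · simp only [Expr.ev, hd, bit_eq_zero, not_exists] at hc
      have hlast : ∀ i : Fin n, (i : ℕ) < m + 1 → ¬ (i : ℕ) < m → ∀ H,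
          ¬ Exceeds (G.versionSpace S) (A₂ 10) i H := by
        intro i h1 h2
        obtain rfl : i = ⟨m, hm⟩ := Fin.ext (by simp; omega)
        exact hc
      rw [update_of_ne (by omega), update_of_ne (by omega), e₃ 4 (by omega) (by omega),
        e₃ 8 (by omega) (by omega)]
      refine hI.imp (And.imp_right fun h i hi => ?_) (And.imp_right ?_)
      · by_cases him : (i : ℕ) < m
        · exact h i him
        · exact hlast i hi him
      · rintro ⟨i₀, h1, h2, h3⟩
        refine ⟨i₀, h1, h2, fun i h4 hi => ?_⟩
        by_cases him : (i : ℕ) < m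
        · exact h3 i h4 him
        · exact hlast i hi him
  · rintro ρ₁ A₁ ⟨e, rfl, hI⟩ h0
    refine Run.cond (e := .reg 4) (T := 7)
      (fun hc => Run.seq (Run.store (Run.assign ⟨?_, ?_⟩)))
      (fun hc => Run.mono (Run.skip ⟨?_, ?_⟩) (by omega) fun _ _ h => h)
    · exact hP.of_eq (by rw [update_of_ne (by omega), e 0 (by omega)])
        (by rw [update_of_ne (by omega), e 2 (by omega)]) fun a ha => update_of_ne ha _ _
    · simp only [Expr.ev] at hc
      rcases hI with ⟨h, -⟩ | ⟨-, i₀, h1, h2, h3⟩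
      · exact absurd h hc
      · refine Or.inr ⟨by rwa [update_of_ne (by omega)], i₀, ?_, h2, fun i hi => h3 i hi i.2, ?_, ?_⟩
        · obtain ⟨H, hH⟩ := h2
          exact hH.2.1
        · simp [Expr.ev, h1]
        · simp [Expr.ev, h1]
    · exact hP.of_eq (e 0 (by omega)) (e 2 (by omega)) fun _ _ => rfl
    · simp only [Expr.ev] at hc
      rcases hI with ⟨h, h'⟩ | ⟨h, -⟩
      · exact Or.inl ⟨h, fun i => h' i i.2⟩
      · exact absurd hc h

end

/-! ### Output -/

/-- Prints the current set. -/
def printCmd : Cmd := .seq (forLoop 5 0 (.output (.cell 10 (.reg 5)))) (.output (.const 2))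

theorem exec_printCmd {n : ℕ} {ρ : ℕ → ℕ} (A : ℕ → ℕ → ℕ) (h0 : ρ 0 = n) (t : ℕ)
    (o : List (ℕ × ℕ)) : ∃ ρ' t' w, Exec printCmd ⟨ρ, A, t, o⟩ ⟨ρ', A, t', o ++ (w ++ [(t', 2)])⟩ ∧
      t' ≤ t + (forTime n 3 + 2) ∧ (∀ y, y ≠ 5 → ρ' y = ρ y) ∧
      w.map Prod.snd = (List.range n).map (A 10) := by
  -- A round takes 11 steps: 4 for the test, 3 for the output and 4 for the increment.
  have key : ∀ m k ρ' t o, k + m = n → ρ' 5 = k → ρ' 0 = n → ∃ ρ'' t' w,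
      Exec (.loop (.sub (.reg 0) (.reg 5)) (.seq (.output (.cell 10 (.reg 5)))
        (.assign 5 (.add (.reg 5) (.const 1))))) ⟨ρ', A, t, o⟩ ⟨ρ'', A, t', o ++ w⟩ ∧
      t' = t + (m * 11 + 4) ∧ (∀ y, y ≠ 5 → ρ'' y = ρ' y) ∧
      w.map Prod.snd = (List.range' k m).map (A 10) := by
    intro m
    induction m with
    | zero =>
      intro k ρ' t o hk h5 h0
      refine ⟨ρ', t + 4, [], ?_, by omega, fun _ _ => rfl, by simp⟩
      rw [List.append_nil]
      exact Exec.loop_false (by simp [Expr.eval, h5, h0, ← hk])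
    | succ m ih =>
      intro k ρ' t o hk h5 h0
      obtain ⟨ρ'', t', w, h1, h2, h3, h4⟩ := ih (k + 1) (update ρ' 5 (k + 1)) (t + 11)
        (o ++ [(t + 7, A 10 k)]) (by omega) (update_self _ _ _) (by rw [update_of_ne (by omega), h0])
      refine ⟨ρ'', t', (t + 7, A 10 k) :: w, ?_, by omega, fun y hy => ?_, ?_⟩
      · rw [← List.append_cons] at h1
        have e1 := Exec.output (.cell 10 (.reg 5)) ⟨ρ', A, t + 4, o⟩
        have e2 := Exec.assign 5 (.add (.reg 5) (.const 1)) ⟨ρ', A, t + 7, o ++ [(t + 7, A 10 k)]⟩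
        simp only [Expr.eval, h5] at e1 e2
        refine Exec.loop_true ?_ (Exec.seq e1 e2) h1
        simp only [Expr.eval, h5, h0]
        omega
      · rw [h3 y hy, update_of_ne hy]
      · simp [List.range'_succ, h4]
  obtain ⟨ρ', t', w, h1, h2, h3, h4⟩ := key n 0 (update ρ 5 0) (t + 2) o (by omega)
    (update_self _ _ _) (by rw [update_of_ne (by omega), h0])
  refine ⟨ρ', t' + 2, w, ?_, by simp only [forTime]; omega, fun y hy => ?_, ?_⟩
  · refine Exec.seq (Exec.seq (Exec.assign 5 (.const 0) ⟨ρ, A, t, o⟩) h1) ?_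
    rw [← List.append_assoc]
    exact Exec.output (.const 2) ⟨ρ', A, t', o ++ w⟩
  · rw [h3 y hy, update_of_ne hy]
  · rw [h4, List.range_eq_range']

end RAM

/-! ### The listing algorithm -/

namespace RAM

open Function SimpleGraph Fm

/-- The main loop: it runs as long as register 4 signals that sets remain to be listed. -/
def enumerateCmd : Cmd := .loop (.reg 4) (.seq completeCmd (.seq printCmd nextCmd))

/-- The algorithm that lists the version space. -/
def mhListCmd : Cmd :=
  .seq prepare (.seq ((Fm.ex 6 2 extF).comp 50) (.seq (.assign 4 (.reg 50)) enumerateCmd))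

theorem printSet_eq {n : ℕ} {H : Set (Fin n)} {f : ℕ → ℕ} (hf : ∀ j, f j ≤ 1)
    (hH : AgreesBelow H f n) : printSet H = (List.range n).map f ++ [2] := by
  unfold printSet
  congr 1
  refine List.ext_getElem (by simp) fun i h1 h2 => ?_
  have hi : i < n := by simpa using h1
  have h3 := hH ⟨i, hi⟩ hi
  have h4 := hf i
  simp only [List.getElem_ofFn, List.getElem_map, List.getElem_range]
  split_ifs with h
  · have h5 : f i ≠ 0 := h3.1 h
    omega
  · have h5 : ¬ f i ≠ 0 := fun hn => h (h3.2 hn)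
    omega

/-! ### Correctness and timing of the listing -/

section

variable {n : ℕ} {G : SimpleGraph (Fin n)} {S : List (Fin n × Bool)}

/-- Here `r` is the reference time for the delay, namely the last completed output or the end of the
sample allowance, and at most `E` steps have passed since. One round prints the first remaining set
and hands the strictly later ones to the next. -/
theorem exec_enumerateCmd (hG : G.Connected) {E d : ℕ} (hE : nextTime (2 * n) ≤ E)
    (hd : E + (2 + completeTime (2 * n) + (forTime n 3 + 2)) ≤ d) (N : ℕ) :
    ∀ (ρ : ℕ → ℕ) (A : ℕ → ℕ → ℕ) (t : ℕ) (o : List (ℕ × ℕ)) (r k : ℕ), Prepared G S ρ A →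
      ρ 4 ≠ 0 → ρ 7 = k → (∀ j, A 10 j ≤ 1) →
      (∃ H ∈ G.versionSpace S, AgreesBelow H (A 10) k) →
      (Remaining (G.versionSpace S) (A 10) k).ncard = N → t ≤ r + E →
      ∃ (s : State) (L : List (Set (Fin n))) (w : List (ℕ × ℕ)),
        Exec enumerateCmd ⟨ρ, A, t, o⟩ s ∧ s.out = o ++ w ∧
        w.map Prod.snd = L.flatMap printSet ∧ L.Nodup ∧
        (∀ H, H ∈ L ↔ H ∈ Remaining (G.versionSpace S) (A 10) k) ∧
        List.IsChain (fun t t' => t' ≤ t + d)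
          (r :: ((w.filter fun o => o.2 = 2).map Prod.fst ++ [s.clock])) ∧
        s.clock ≤ r + (L.length + 1) * d := by
  induction N using Nat.strong_induction_on with
  | _ N ih =>
    intro ρ A t o r k hP h4 h7 hbit hex hN ht
    obtain ⟨ρ₁, A₁, t₁, ex₁, ht₁, hP₁, hbit₁, hk₁, ⟨H₀, hH₀, hA₀⟩, hmin₁⟩ :=
      run_completeCmd hG hP h7 hbit hex (t + 2) o
    obtain ⟨ρ₂, t₂, w₂, ex₂, ht₂, e₂, hw₂⟩ := exec_printCmd A₁ hP₁.reg0 t₁ o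
    have hP₂ : Prepared G S ρ₂ A₁ :=
      hP₁.of_eq (e₂ 0 (by omega)) (e₂ 2 (by omega)) fun _ _ => rfl
    obtain ⟨ρ₃, A₃, t₃, ex₃, ht₃, hP₃, hnext⟩ :=
      run_nextCmd hG hP₂ t₂ (o ++ (w₂ ++ [(t₂, 2)]))
    have hbody : ∀ s, Exec enumerateCmd ⟨ρ₃, A₃, t₃, o ++ (w₂ ++ [(t₂, 2)])⟩ s →
        Exec enumerateCmd ⟨ρ, A, t, o⟩ s := fun s hs =>
      Exec.loop_true h4 (Exec.seq ex₁ (Exec.seq ex₂ ex₃)) hs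
    have hrem := mem_remaining_iff hH₀ hA₀ hk₁ hmin₁
    have hval : (w₂ ++ [(t₂, 2)]).map Prod.snd = printSet H₀ := by
      rw [List.map_append, hw₂, printSet_eq hbit₁ hA₀]
      rfl
    have htimes : ((w₂ ++ [(t₂, 2)]).filter fun o : ℕ × ℕ => o.2 = 2).map Prod.fst = [t₂] := by
      -- Entries of a characteristic vector are at most 1, so they are never mistaken for end
      -- markers.
      have hnil : w₂.filter (fun o => decide (o.2 = 2)) = [] := by
        rw [List.filter_eq_nil_iff]
        intro x hx
        have hx' : x.2 ∈ (List.range n).map (A₁ 10) := by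
          rw [← hw₂]
          exact List.mem_map_of_mem hx
        obtain ⟨j, -, hj⟩ := List.mem_map.1 hx'
        have := hbit₁ j
        simp only [decide_eq_true_eq]
        omega
      rw [List.filter_append, hnil]
      simp
    have hH₀n : ∀ i, ¬ Exceeds (G.versionSpace S) (A₁ 10) i H₀ := fun i hi =>
      (hA₀ i i.2).1 hi.2.2.2 hi.2.1
    have ht₂' : t₂ ≤ r + d := by omega
    rcases hnext with ⟨hz, hno⟩ | ⟨hz, i₀, hi₀, ⟨H₁, hH₁⟩, hmax, hA₃, h7₃⟩
    · refine ⟨⟨ρ₃, A₃, t₃ + 2, o ++ (w₂ ++ [(t₂, 2)])⟩, [H₀], w₂ ++ [(t₂, 2)],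
        hbody _ (Exec.loop_false hz), rfl, by simpa using hval, by simp, fun H => ?_, ?_, ?_⟩
      · rw [hrem]
        simp [hno]
      · rw [htimes]
        simp only [List.cons_append, List.nil_append, List.isChain_cons_cons,
          List.IsChain.singleton, and_true]
        omega
      · simp only [List.length_singleton]
        omega
    · have hrem' := exists_exceeds_iff hi₀ hmax
      rw [← hA₃] at hrem'
      -- The set just printed does not exceed itself, so it drops out; this also yields `L.Nodup`.
      have hlt : (Remaining (G.versionSpace S) (A₃ 10) (i₀ + 1)).ncard < N := by
        rw [← hN]
        refine Set.ncard_lt_ncard ⟨fun H hH => (hrem H).2 (Or.inr ((hrem' H).2 hH)), fun hsub => ?_⟩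
        obtain ⟨i, hi⟩ := (hrem' H₀).2 (hsub ((hrem H₀).2 (Or.inl rfl)))
        exact hH₀n i hi
      have hex₃ : ∃ H ∈ G.versionSpace S, AgreesBelow H (A₃ 10) (i₀ + 1) := by
        refine ⟨H₁, hH₁.1, fun v hv => ?_⟩
        rw [hA₃]
        by_cases hvi : v = i₀
        · subst hvi
          simp [hH₁.2.2.2]
        · have hne : (v : ℕ) ≠ i₀ := fun h => hvi (Fin.ext h)
          rw [update_of_ne hne]
          exact hH₁.2.2.1 v (by omega)
      have hbit₃ : ∀ j, A₃ 10 j ≤ 1 := by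
        intro j
        rw [hA₃]
        by_cases hj : j = i₀
        · rw [hj, update_self]
        · rw [update_of_ne hj]
          exact hbit₁ j
      obtain ⟨s, L, w, exs, hout, hw, hL, hmem, hchain, hclock⟩ := ih _ hlt ρ₃ A₃ t₃
        (o ++ (w₂ ++ [(t₂, 2)])) t₂ (i₀ + 1) hP₃ hz h7₃ hbit₃ hex₃ rfl (by omega)
      refine ⟨s, H₀ :: L, (w₂ ++ [(t₂, 2)]) ++ w, hbody s exs, by rw [hout, List.append_assoc], ?_, ?_,
        fun H => ?_, ?_, ?_⟩
      · rw [List.map_append, hval, hw, List.flatMap_cons]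
      · rw [List.nodup_cons]
        refine ⟨fun h => ?_, hL⟩
        obtain ⟨i, hi⟩ := (hrem' H₀).2 ((hmem H₀).1 h)
        exact hH₀n i hi
      · rw [List.mem_cons, hrem, hmem, hrem']
      · rw [List.filter_append, List.map_append, htimes]
        simp only [List.cons_append, List.nil_append, List.isChain_cons_cons]
        exact ⟨ht₂', hchain⟩
      · rw [List.length_cons, Nat.succ_mul]
        omega

/-- The time until the main loop starts, apart from reading the sample, and between an output and
the next round of the main loop. -/
def idleTime (n : ℕ) : ℕ :=
  6 + prepareTime (2 * n) + (Fm.ex 6 2 extF).time (2 * n) + 2 + nextTime (2 * n)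

/-- A bound for the delay. -/
def delayTime (n : ℕ) : ℕ := idleTime n + (2 + completeTime (2 * n) + (forTime n 3 + 2))

theorem isPoly_tab4Time (φ : Fm) : IsPoly fun N => tab4Time φ N :=
  .forTime .id (.forTime .id (.forTime .id (.forTime .id (φ.isPoly_time.add (.const _)))))

theorem isPoly_closureTime : IsPoly closureTime :=
  .add (isPoly_tab4Time _) (.forTime .id (.add (isPoly_tab4Time _) (isPoly_tab4Time _)))

theorem isPoly_prepareTime : IsPoly prepareTime :=
  have h : IsPoly fun N => forTime N 8 := .forTime .id (.const _)
  .add (.const _) (h.add (h.add (.add (.const _) (h.add (.add (.const _)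
    (h.add isPoly_closureTime))))))

theorem isPoly_delayTime : IsPoly delayTime := by
  have h2 : IsPoly fun n => 2 * n := .mul (.const _) .id
  have hc : IsPoly completeTime :=
    .forTime .id (.add (.const _) (.add (.const _) (extF.isPoly_time.add (.const _))))
  have hn : IsPoly nextTime :=
    .add (.const _) (.add (.forTime .id (.add (.const _) (.add (Fm.isPoly_time _) (.const _))))
      (.const _))
  have hi : IsPoly idleTime :=
    .add (.add (.add (.add (.const _) (isPoly_prepareTime.comp h2))
      ((Fm.isPoly_time (Fm.ex 6 2 extF)).comp h2)) (.const _)) (hn.comp h2)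
  exact hi.add (.add (.add (.const _) (hc.comp h2)) (.add (.forTime .id (.const _)) (.const _)))

theorem exec_mhListCmd (hG : G.Connected) (S : List (Fin n × Bool)) :
    ∃ (s : State) (L : List (Set (Fin n))), Exec mhListCmd (inputState G S) s ∧
      s.out.map Prod.snd = L.flatMap printSet ∧ L.Nodup ∧ (∀ H, H ∈ L ↔ H ∈ G.versionSpace S) ∧
      s.HasDelay (17 * S.length) (delayTime n) ∧
      s.clock ≤ 17 * S.length + (L.length + 1) * delayTime n := by
  obtain ⟨ρ₁, A₁, t₁, ex₁, ht₁, hP₁, h5₁, h7₁, hbit₁⟩ := run_prepare G S 0 []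
  have hwf : (Fm.ex 6 2 extF).WF 50 := ⟨by omega, by omega, Or.inr rfl, wf_extF⟩
  obtain ⟨ρ₂, A₂, t₂, ex₂, ht₂, rfl, e₂, hd₂⟩ := (Fm.ex 6 2 extF).run hwf (by omega)
    (ρ := ρ₁) (A := A₁) (N := 2 * n) (by rw [hP₁.reg0]; omega) (by rw [hP₁.reg2]) t₁ []
  -- `extF` always prescribes one literal. For the empty prefix all literals are tried, since every
  -- halfspace satisfies one of the two literals of any vertex.
  have hne : (Fm.ex 6 2 extF).Holds A₂ ρ₁ ↔ (G.versionSpace S).Nonempty := by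
    rw [holds_ex, hP₁.reg2, exists_lt_enc_iff]
    have hext : ∀ l : Lit (Fin n), extF.Holds A₂ (update ρ₁ 6 (enc l)) ↔
        ∃ H ∈ G.versionSpace S, AgreesBelow H (A₂ 10) 0 ∧ l.Sat H := fun l =>
      (hP₁.of_eq (ρ' := update ρ₁ 6 (enc l)) (update_of_ne (by omega) _ _)
        (update_of_ne (by omega) _ _) fun _ _ => rfl).holds_extF hG
        (by rw [update_of_ne (by omega), h5₁]) (Nat.zero_le n) (update_self _ _ _)
    constructor
    · rintro ⟨l, hl⟩
      obtain ⟨H, hH, -⟩ := (hext l).1 hl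
      exact ⟨H, hH⟩
    · rintro ⟨H, hH⟩
      obtain ⟨v⟩ := hG.nonempty
      by_cases hv : v ∈ H
      · exact ⟨(v, true), (hext _).2 ⟨H, hH, fun _ h => absurd h (Nat.not_lt_zero _), by simpa⟩⟩
      · exact ⟨(v, false), (hext _).2 ⟨H, hH, fun _ h => absurd h (Nat.not_lt_zero _), by simpa⟩⟩
  rw [bit_congr hne] at hd₂
  set ρ₃ := update ρ₂ 4 (ρ₂ 50) with hρ₃
  have hstart : ∀ s, Exec enumerateCmd ⟨ρ₃, A₂, t₂ + 2, []⟩ s → Exec mhListCmd (inputState G S) s :=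
    fun s hs => Exec.seq ex₁ (Exec.seq ex₂ (Exec.seq (Exec.assign 4 (.reg 50) ⟨ρ₂, A₂, t₂, []⟩) hs))
  have ht₃ : t₂ + 2 + nextTime (2 * n) ≤ 17 * S.length + idleTime n := by
    simp only [forTime] at ht₁
    simp only [idleTime]
    omega
  have hreg : ∀ y < 50, y ≠ 4 → ρ₃ y = ρ₁ y := fun y hy h4 => by
    rw [hρ₃, update_of_ne h4, e₂ y hy]
  by_cases hVS : (G.versionSpace S).Nonempty
  · obtain ⟨s, L, w, exs, hout, hw, hL, hmem, hchain, hclock⟩ := exec_enumerateCmd hG (S := S)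
      (E := idleTime n) (d := delayTime n) (by simp only [idleTime]; omega) le_rfl _ ρ₃ A₂ (t₂ + 2) []
      (17 * S.length) 0
      (hP₁.of_eq (hreg 0 (by omega) (by omega)) (hreg 2 (by omega) (by omega)) fun _ _ => rfl)
      (by rw [hρ₃, update_self, hd₂, bit_ne_zero]; exact hVS)
      (by rw [hreg 7 (by omega) (by omega), h7₁]) hbit₁
      (hVS.imp fun H hH => ⟨hH, fun _ h => absurd h (Nat.not_lt_zero _)⟩) rfl (by omega)
    rw [List.nil_append] at hout
    refine ⟨s, L, hstart s exs, by rw [hout, hw], hL, fun H => by rw [hmem, remaining_zero], ?_, hclock⟩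
    unfold State.HasDelay State.outputTimes
    rw [hout]
    exact hchain
  · refine ⟨⟨ρ₃, A₂, t₂ + 2 + 2, []⟩, [], hstart _ (Exec.loop_false ?_), rfl, by simp, fun H => ?_,
      ?_, ?_⟩
    · change ρ₃ 4 = 0
      rw [hρ₃, update_self, hd₂, bit_false hVS]
    · rw [Set.not_nonempty_iff_eq_empty.1 hVS]
      simp
    · simp only [State.HasDelay, State.outputTimes, List.filter_nil, List.map_nil, List.nil_append,
        List.isChain_cons_cons, List.IsChain.singleton, and_true, delayTime]
      omega
    · simp only [List.length_nil, delayTime]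
      omega

end

end RAM

theorem mainTheorem6 :
    ∃ (mhList : RAM.Cmd) (p : Polynomial ℕ) (c : ℕ),
      ∀ (n : ℕ) (G : SimpleGraph (Fin n)) (S : List (Fin n × Bool)), G.Connected →
        ∃ (s : RAM.State) (L : List (Set (Fin n))),
          RAM.Exec mhList (RAM.inputState G S) s ∧
          s.out.map Prod.snd = L.flatMap RAM.printSet ∧
          L.Nodup ∧
          (∀ H : Set (Fin n), H ∈ L ↔ H ∈ G.versionSpace S) ∧
          s.HasDelay (c * S.length) (p.eval n) ∧
          s.clock ≤ c * S.length + max 1 (G.versionSpace S).ncard * p.eval n := by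
  classical
  obtain ⟨p, hp⟩ := RAM.isPoly_delayTime
  -- Reading a sample entry takes at most 9 steps plus 8 for the loop. The factor 2 absorbs the
  -- final delay, as `L.length + 1 ≤ 2 * max 1 L.length`.
  refine ⟨RAM.mhListCmd, 2 * p, 17, fun n G S hG => ?_⟩
  obtain ⟨s, L, hs, hout, hL, hmem, hdelay, hclock⟩ := RAM.exec_mhListCmd hG S
  have hp2 : (2 * p).eval n = 2 * RAM.delayTime n := by
    rw [Polynomial.eval_mul, hp n]
    simp
  have hcard : (G.versionSpace S).ncard = L.length := by
    have : G.versionSpace S = (L.toFinset : Set (Set (Fin n))) := by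
      ext H
      simp [hmem]
    rw [this, Set.ncard_coe_finset, List.toFinset_card_of_nodup hL]
  refine ⟨s, L, hs, hout, hL, hmem, ?_, ?_⟩
  · rw [hp2]
    exact List.IsChain.imp (fun _ _ h => h.trans (by omega)) hdelay
  · rw [hp2, hcard]
    refine hclock.trans (Nat.add_le_add_left ?_ _)
    calc (L.length + 1) * RAM.delayTime n ≤ (max 1 L.length * 2) * RAM.delayTime n :=
          Nat.mul_le_mul_right _ (by omega)
      _ = max 1 L.length * (2 * RAM.delayTime n) := Nat.mul_assoc _ _ _
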